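/- **Setting.** Let $X$ be a measurable space whose points are measurable (for instance $X\subseteq\mathbb R^d$). Distributions are probability measures on $X\times\{0,1\}$; a predictor is a measurable map $h:X\to[0,1]$; groups are measurable subsets of $X$; $D_g$ is $D$ conditioned on $x\in g$. A loss $L$ assigns to each distribution $D$ and predictor $h$ a number $L_D(h)\in[0,1]$, with $L_D(h)=L_D(h')$ whenever $h=h'$ $D$-almost everywhere. For a nonempty sample $S$, $L_S(h)$ is the loss at the empirical distribution of $S$; it is assumed that $(\theta,S)\mapsto L_S(h_\theta)$ is measurable for every jointly measurable family $(h_\theta)$ of predictors. Let $f:X\times[0,1]\to[0,1]$ be measurable. $L$ is *$f$-proper* if for every $D$ the predictor $x\mapsto f(x,\mathbb E_D[y\mid x])$ minimizes $L_D$ over all predictors. $L$ has *uniform convergence* with sample complexity $m^{UC}(\varepsilon,\delta,k)\ge 1$ if for all $\varepsilon,\delta\in(0,1)$, every finite class $H$, every $D$ and every $m\ge m^{UC}(\varepsilon,\delta,|H|)$, with probability at least $1-\delta$ over $S\sim D^m$ we have $|L_S(h)-L_D(h)|\le\varepsilon$ for all $h\in H$, and $m^{UC}(\varepsilon,\delta,k)$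 is bounded by a polynomial in $1/\varepsilon,1/\delta,\log k$. (Here and below $\log 0:=0$.) A (possibly randomized) learner is given $\varepsilon,\delta,\gamma\in(0,1)$, a finite class $H$, a finite collection $G$ of groups and a sample, and outputs a predictor. It *multi-group learns* $L$ with sample complexity $m_L(\varepsilon,\delta,\gamma,|H|,|G|)$ if for all $\varepsilon,\delta,\gamma,H,G$, all $D$ and all $m\ge m_L(\varepsilon,\delta,\gamma,|H|,|G|)$, on $m$ i.i.d. examples from $D$ it outputs, with probability at least $1-\delta$ over the examples and its coins, a predictor $h$ such that $$L_{D_g}(h)\le L_{D_g}(h')+\varepsilon\qquad\text{for all } h'\in H \text{ and all } g\in G \text{ with } \Pr_D[x\in g]\ge\gamma .$$ $L$ is *multi-group learnable* if such a learner exists with $m_L$ bounded by a polynomial in $1/\varepsilon,1/\delta,1/\gamma,\log|H|,\log|G|$. **Lemma 4.4.** If $L$ is $f$-proper and has uniform convergence with sample complexity $m^{UC}$, then $L$ is multi-group learnable. Moreover there is a multi-group learner for $L$ of the following form, with sample complexity polynomial in $1/\varepsilon,1/\delta,1/\gamma,\log|H|,\log|G|$: it outputs $x\mapsto f(x,\tilde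 p(x))$, where $\tilde p$ is the output of a learner which, on the same number of examples, for every instance satisfies with probability at least $1-\delta/4$ the outcome-indistinguishability condition $$\Bigl|\Pr_{D^k}\bigl[A_{g,h}\bigl((x_i,y_i,\tilde p(x_i))_{i\le k}\bigr)=1\bigr]-\Pr_{\tilde D^k}\bigl[A_{g,h}\bigl((x_i,y_i,\tilde p(x_i))_{i\le k}\bigr)=1\bigr]\Bigr|\le\frac{\delta}{4}\qquad\text{for all } g\in G,\ h\in H.$$ Here $\tilde D$ has the same marginal on $X$ as $D$ and labels $y\sim\mathrm{Ber}(\tilde p(x))$, $k=\bigl\lceil\tfrac{10}{\gamma}\log\tfrac4\delta\cdot m^{UC}(\tfrac\varepsilon4,\tfrac\delta4,|H|+1)\bigr\rceil$, and $A_{g,h}$ accepts $(x_i,y_i,p_i)_{i\le k}$ iff no $x_i$ lies in $g$ or $L_{S_g}(f_g)\le L_{S_g}(h)+\varepsilon/2$, where $S_g$ is the subsample of those $(x_i,y_i)$ with $x_i\in g$, and $f_g(x_i)=f(x_i,p_i)$ (for one fixed choice of $i$ should a point repeat), $f_g=0$ off the sample. -/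

import Mathlib

open MeasureTheory

universe u

noncomputable section

namespace MultiGroup

/-- Predictors: measurable maps from the feature space to `[0,1]`. -/
def Predictor (X : Type u) [MeasurableSpace X] : Type u :=
  {h : X → unitInterval // Measurable h}

instance (X : Type u) [MeasurableSpace X] : CoeFun (Predictor X) (fun _ => X → unitInterval) :=
  ⟨Subtype.val⟩

/-- The empirical distribution of the subsample of `S` indexed by `I`
(a probability measure as soon as `I` is nonempty; it is only used then). -/
def empiricalOn {X : Type u} [MeasurableSpace X] {m : ℕ} (I : Finset (Fin m))
    (S : Fin m → X × Bool) : Measure (X × Bool) :=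
  (I.card : ENNReal)⁻¹ • ∑ i ∈ I, Measure.dirac (S i)

/-- The empirical distribution of the sample `S`. -/
def empirical {X : Type u} [MeasurableSpace X] {m : ℕ} (S : Fin m → X × Bool) :
    Measure (X × Bool) :=
  empiricalOn Finset.univ S

/-- The law of `m` i.i.d. examples drawn from `D`. -/
def iidLaw {X : Type u} [MeasurableSpace X] (D : Measure (X × Bool)) (m : ℕ) :
    Measure (Fin m → X × Bool) :=
  Measure.pi (fun _ => D)

/-- The distribution `D_g`: `D` conditioned on the features lying in `g`. -/
def restrictTo {X : Type u} [MeasurableSpace X] (D : Measure (X × Bool)) (g : Set X) :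
    Measure (X × Bool) :=
  ProbabilityTheory.cond D (Prod.fst ⁻¹' g)

/-- A general loss function: it assigns to a distribution `D` on `X × {0,1}` and a predictor `h`
a number in `[0,1]` that does not depend on what `h` does outside `D`. Only its values at
probability measures matter. -/
structure Loss (X : Type u) [MeasurableSpace X] where
  risk : Measure (X × Bool) → Predictor X → ℝ
  risk_mem : ∀ (D : Measure (X × Bool)) [IsProbabilityMeasure D] (h : Predictor X),
    risk D h ∈ Set.Icc (0 : ℝ) 1
  risk_congr : ∀ (D : Measure (X × Bool)) [IsProbabilityMeasure D] (h h' : Predictor X),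
    (∀ᵐ z ∂D, h z.1 = h' z.1) → risk D h = risk D h'
  /-- Regularity: the empirical loss is a measurable function of the sample and of the parameter
  of any jointly measurable family of predictors. -/
  measurable_risk : ∀ (Θ : Type u) [MeasurableSpace Θ] (h : Θ → Predictor X),
    Measurable (fun q : Θ × X => h q.1 q.2) → ∀ m : ℕ, 0 < m →
      Measurable (fun q : Θ × (Fin m → X × Bool) => risk (empirical q.2) (h q.1))

/-- The predictor `x ↦ f(x, p(x))`. -/
def localPredictor {X : Type u} [MeasurableSpace X] (f : X × unitInterval → unitInterval)
    (hf : Measurable f) (p : Predictor X) : Predictor X :=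
  ⟨fun x => f (x, p x), hf.comp (measurable_id.prodMk p.2)⟩

/-- `p` is a version of the conditional expectation `x ↦ E[y | x]` under `D`. -/
def IsCondMean {X : Type u} [MeasurableSpace X] (D : Measure (X × Bool)) (p : Predictor X) :
    Prop :=
  (fun z : X × Bool => (p z.1 : ℝ)) =ᵐ[D]
    condExp (MeasurableSpace.comap (Prod.fst : X × Bool → X) inferInstance) D
      (fun z => if z.2 = true then (1 : ℝ) else 0)

/-- `L` is `f`-proper: for every distribution `D`, the predictor `x ↦ f(x, E[y | x])` minimizes
the loss `L_D` over all predictors. -/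
def IsProper {X : Type u} [MeasurableSpace X] (L : Loss X) (f : X × unitInterval → unitInterval)
    (hf : Measurable f) : Prop :=
  ∀ (D : Measure (X × Bool)) [IsProbabilityMeasure D] (p : Predictor X), IsCondMean D p →
    ∀ h : Predictor X, L.risk D (localPredictor f hf p) ≤ L.risk D h

/-- `L` has the uniform convergence property for finite classes, with sample complexity `mUC`
(arguments: accuracy, failure probability, size of the class), which is bounded by a polynomial
in `1/ε`, `1/δ` and the logarithm of the size of the class. Sample sizes are positive, since the
empirical distribution of an empty sample does not exist. -/
def HasUniformConvergence {X : Type u} [MeasurableSpace X] (L : Loss X) (mUC : ℝ → ℝ → ℕ → ℕ) :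
    Prop :=
  (∀ ε ∈ Set.Ioo (0 : ℝ) 1, ∀ δ ∈ Set.Ioo (0 : ℝ) 1, ∀ k : ℕ, 1 ≤ mUC ε δ k) ∧
  (∀ ε ∈ Set.Ioo (0 : ℝ) 1, ∀ δ ∈ Set.Ioo (0 : ℝ) 1, ∀ H : Finset (Predictor X),
    ∀ (D : Measure (X × Bool)) [IsProbabilityMeasure D], ∀ m : ℕ, mUC ε δ H.card ≤ m →
      iidLaw D m {S | ¬ ∀ h ∈ H, |L.risk (empirical S) h - L.risk D h| ≤ ε} ≤ ENNReal.ofReal δ) ∧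
  ∃ P : MvPolynomial (Fin 3) ℝ, ∀ ε ∈ Set.Ioo (0 : ℝ) 1, ∀ δ ∈ Set.Ioo (0 : ℝ) 1, ∀ k : ℕ,
    (mUC ε δ k : ℝ) ≤ MvPolynomial.eval ![1 / ε, 1 / δ, Real.log k] P

/-- A (possibly randomized) learning algorithm: from the parameters `ε δ γ`, the class `H`, the
collection of groups `G`, a sample of any size `m`, and coins `ω`, it produces a predictor. -/
abbrev Learner (X : Type u) [MeasurableSpace X] (Ω : Type) : Type u :=
  (ε δ γ : ℝ) → Finset (Predictor X) → Finset (Set X) →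
    (m : ℕ) → (Fin m → X × Bool) → Ω → Predictor X

/-- `h` is `ε`-competitive with the class `H` on every group of `G` of mass at least `γ`. -/
def IsMultiGroupCompetitive {X : Type u} [MeasurableSpace X] (L : Loss X)
    (D : Measure (X × Bool)) (ε γ : ℝ) (H : Finset (Predictor X)) (G : Finset (Set X))
    (h : Predictor X) : Prop :=
  ∀ g ∈ G, γ ≤ D.real (Prod.fst ⁻¹' g) →
    ∀ h' ∈ H, L.risk (restrictTo D g) h ≤ L.risk (restrictTo D g) h' + ε

/-- On every instance, given at least `mL ε δ γ |H| |G|` i.i.d. examples, the learner `A` with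
coins drawn from `ν` outputs a multi-group competitive predictor with probability at least
`1 - δ` (the outer measure of the failure event is at most `δ`). -/
def IsMultiGroupLearner {X : Type u} [MeasurableSpace X] (L : Loss X)
    (mL : ℝ → ℝ → ℝ → ℕ → ℕ → ℕ) {Ω : Type} [MeasurableSpace Ω] (ν : Measure Ω)
    (A : Learner X Ω) : Prop :=
  ∀ ε ∈ Set.Ioo (0 : ℝ) 1, ∀ δ ∈ Set.Ioo (0 : ℝ) 1, ∀ γ ∈ Set.Ioo (0 : ℝ) 1,
    ∀ (H : Finset (Predictor X)) (G : Finset (Set X)), (∀ g ∈ G, MeasurableSet g) →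
    ∀ (D : Measure (X × Bool)) [IsProbabilityMeasure D], ∀ m : ℕ,
      mL ε δ γ H.card G.card ≤ m →
      ((iidLaw D m).prod ν)
        {s | ¬ IsMultiGroupCompetitive L D ε γ H G (A ε δ γ H G m s.1 s.2)} ≤ ENNReal.ofReal δ

/-- The sample complexity is at most a polynomial in `1/ε`, `1/δ`, `1/γ`, `log |H|`, `log |G|`. -/
def IsPolySampleComplexity (mL : ℝ → ℝ → ℝ → ℕ → ℕ → ℕ) : Prop :=
  ∃ P : MvPolynomial (Fin 5) ℝ,
    ∀ ε ∈ Set.Ioo (0 : ℝ) 1, ∀ δ ∈ Set.Ioo (0 : ℝ) 1, ∀ γ ∈ Set.Ioo (0 : ℝ) 1, ∀ a b : ℕ,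
      (mL ε δ γ a b : ℝ) ≤
        MvPolynomial.eval ![1 / ε, 1 / δ, 1 / γ, Real.log a, Real.log b] P

/-- Multi-group (agnostic PAC) learnability of a loss function. -/
def MultiGroupLearnable {X : Type u} [MeasurableSpace X] (L : Loss X) : Prop :=
  ∃ mL : ℝ → ℝ → ℝ → ℕ → ℕ → ℕ, IsPolySampleComplexity mL ∧
    ∃ (Ω : Type) (_ : MeasurableSpace Ω) (ν : Measure Ω) (_ : IsProbabilityMeasure ν)
      (A : Learner X Ω), IsMultiGroupLearner L mL ν A

/-- The modeled distribution `D(p)`: features from the marginal of `D`, and then a label drawn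
from the Bernoulli distribution with parameter `p(x)`. -/
def modeled {X : Type u} [MeasurableSpace X] (D : Measure (X × Bool)) (p : Predictor X) :
    Measure (X × Bool) :=
  ((D.map Prod.fst).withDensity (fun x => ENNReal.ofReal (p x))).map (fun x => (x, true)) +
  ((D.map Prod.fst).withDensity (fun x => ENNReal.ofReal (1 - p x))).map (fun x => (x, false))

/-- A `k`-sample distinguisher: which tuples `(xᵢ, yᵢ, pᵢ)` it accepts. -/
abbrev Distinguisher (X : Type u) (k : ℕ) : Type u :=
  (Fin k → (X × Bool) × unitInterval) → Prop

/-- The probability that `A` accepts on `k` i.i.d. examples from `D` with predictions by `p`. -/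
def acceptProb {X : Type u} [MeasurableSpace X] {k : ℕ} (D : Measure (X × Bool))
    (A : Distinguisher X k) (p : Predictor X) : ℝ :=
  (iidLaw D k).real {s | A (fun i => (s i, p (s i).1))}

/-- Outcome indistinguishability of the predictor `p` with respect to the collection `𝒜`. -/
def IsOutcomeIndist {X : Type u} [MeasurableSpace X] {k : ℕ} (D : Measure (X × Bool))
    (𝒜 : Set (Distinguisher X k)) (τ : ℝ) (p : Predictor X) : Prop :=
  ∀ A ∈ 𝒜, |acceptProb D A p - acceptProb (modeled D p) A p| ≤ τ

open Classical in
/-- The predictor with value `q i` at `x i` (for a fixed choice of `i`, should the points repeat)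
and value `0` off the given points. -/
def samplePredictor {X : Type u} [MeasurableSpace X] [MeasurableSingletonClass X] {k : ℕ}
    (x : Fin k → X) (q : Fin k → unitInterval) : Predictor X :=
  ⟨fun a => if ha : ∃ i, x i = a then q ha.choose else 0, by
    refine (measurable_const (a := (0 : unitInterval))).measurable_of_countable_ne ?_
    refine (Set.finite_range x).countable.mono ?_
    intro a ha
    by_contra hn
    have hn' : ¬ ∃ i, x i = a := hn
    exact ha (by rw [dif_neg hn'])⟩

open Classical in
/-- The distinguisher `A_{g,h}` (with its `k`, `α`, `L`, `f`): on input `(xᵢ, yᵢ, pᵢ)`, it accepts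
if, on the subsample that falls in `g`, the empirical loss of the predictor `xᵢ ↦ f(xᵢ, pᵢ)` is at
most that of `h` plus `2α`. It accepts if no example falls in `g`. -/
def groupDistinguisher {X : Type u} [MeasurableSpace X] [MeasurableSingletonClass X]
    (L : Loss X) (f : X × unitInterval → unitInterval) (k : ℕ) (α : ℝ) (g : Set X)
    (h : Predictor X) : Distinguisher X k :=
  fun s =>
    let I : Finset (Fin k) := Finset.univ.filter (fun i => (s i).1.1 ∈ g)
    let Sg : Measure (X × Bool) := empiricalOn I (fun i => (s i).1)
    let fg : Predictor X :=
      samplePredictor (fun i => (s i).1.1) (fun i => f ((s i).1.1, (s i).2))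
    I.Nonempty → L.risk Sg fg ≤ L.risk Sg h + 2 * α

/-- The collection of the distinguishers `A_{g,h}`, one for each `g ∈ G` and `h ∈ H`. -/
def groupDistinguishers {X : Type u} [MeasurableSpace X] [MeasurableSingletonClass X]
    (L : Loss X) (f : X × unitInterval → unitInterval) (k : ℕ) (α : ℝ)
    (H : Finset (Predictor X)) (G : Finset (Set X)) : Set (Distinguisher X k) :=
  {A | ∃ g ∈ G, ∃ h ∈ H, A = groupDistinguisher L f k α g h}

/-- The number of examples read by each distinguisher. -/
def distinguisherSize (mUC : ℝ → ℝ → ℕ → ℕ) (ε δ γ : ℝ) (a : ℕ) : ℕ :=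
  ⌈10 / γ * Real.log (4 / δ) * (mUC (ε / 4) (δ / 4) (a + 1) : ℝ)⌉₊

/-- On every instance, given at least `mL ε δ γ |H| |G|` i.i.d. examples, the learner `O` with
coins drawn from `ν` outputs, with probability at least `1 - δ/4`, a predictor that is outcome
indistinguishable up to `δ/4` with respect to the distinguishers `A_{g,h}`, `g ∈ G`, `h ∈ H`. -/
def IsOutcomeIndistLearner {X : Type u} [MeasurableSpace X] [MeasurableSingletonClass X]
    (L : Loss X) (f : X × unitInterval → unitInterval) (mUC : ℝ → ℝ → ℕ → ℕ)
    (mL : ℝ → ℝ → ℝ → ℕ → ℕ → ℕ) {Ω : Type} [MeasurableSpace Ω] (ν : Measure Ω)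
    (O : Learner X Ω) : Prop :=
  ∀ ε ∈ Set.Ioo (0 : ℝ) 1, ∀ δ ∈ Set.Ioo (0 : ℝ) 1, ∀ γ ∈ Set.Ioo (0 : ℝ) 1,
    ∀ (H : Finset (Predictor X)) (G : Finset (Set X)), (∀ g ∈ G, MeasurableSet g) →
    ∀ (D : Measure (X × Bool)) [IsProbabilityMeasure D], ∀ m : ℕ,
      mL ε δ γ H.card G.card ≤ m →
      ((iidLaw D m).prod ν)
        {s | ¬ IsOutcomeIndist D
          (groupDistinguishers L f (distinguisherSize mUC ε δ γ H.card) (ε / 4) H G) (δ / 4)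
          (O ε δ γ H G m s.1 s.2)} ≤ ENNReal.ofReal (δ / 4)

end MultiGroup

end

noncomputable section

namespace MultiGroup

section ProductMeasures

variable {ι κ : Type*} [Fintype ι] [Fintype κ] {Y : Type*} [MeasurableSpace Y]

/-- Restricting independent coordinates along an injection of the index types. -/
lemma pi_map_comp_injective (ν : κ → Measure Y) [∀ j, IsProbabilityMeasure (ν j)]
    (e : ι → κ) (he : Function.Injective e) :
    (Measure.pi ν).map (fun s i => s (e i)) = Measure.pi (fun i => ν (e i)) := by
  classical
  symm
  refine Measure.pi_eq fun s hs => ?_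
  have hm : Measurable (fun (w : κ → Y) i => w (e i)) := by fun_prop
  rw [Measure.map_apply hm (MeasurableSet.univ_pi hs)]
  have : (fun (w : κ → Y) i => w (e i)) ⁻¹' Set.univ.pi s
      = Set.univ.pi (fun j => if h : ∃ i, e i = j then s h.choose else Set.univ) := by
    ext w
    simp only [Set.mem_preimage, Set.mem_univ_pi]
    constructor
    · intro h j
      split_ifs with hj
      · have := h hj.choose
        rwa [hj.choose_spec] at this
      · trivial
    · intro h i
      have := h (e i)
      have hi : ∃ i', e i' = e i := ⟨i, rfl⟩
      rw [dif_pos hi, he hi.choose_spec] at this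
      exact this
  rw [this, Measure.pi_pi]
  have hval : ∀ i, (if h : ∃ i', e i' = e i then s h.choose else Set.univ) = s i := by
    intro i
    have hi : ∃ i', e i' = e i := ⟨i, rfl⟩
    rw [dif_pos hi, he hi.choose_spec]
  rw [← Finset.prod_subset (Finset.subset_univ (Finset.univ.map ⟨e, he⟩))]
  · rw [Finset.prod_map]
    exact Finset.prod_congr rfl fun i _ => by
      simp only [Function.Embedding.coeFn_mk]; rw [hval]
  · intro j _ hj
    rw [dif_neg, measure_univ]
    rintro ⟨i, rfl⟩
    exact hj (by simp)

/-- Resampling one coordinate of a vector of independent coordinates. -/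
lemma pi_update_eq_map [DecidableEq ι] (ν : ι → Measure Y) [∀ j, IsProbabilityMeasure (ν j)]
    (i : ι) (μ : Measure Y) [IsProbabilityMeasure μ] :
    Measure.pi (Function.update ν i μ) =
      ((Measure.pi ν).prod μ).map (fun q => Function.update q.1 i q.2) := by
  have hinst : ∀ j, IsProbabilityMeasure (Function.update ν i μ j) := by
    intro j
    by_cases h : j = i
    · subst h; simpa
    · simpa [h] using (inferInstance : IsProbabilityMeasure (ν j))
  refine Measure.pi_eq fun s hs => ?_
  have hm : Measurable (fun q : (ι → Y) × Y => Function.update q.1 i q.2) := by fun_prop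
  rw [Measure.map_apply hm (MeasurableSet.univ_pi hs)]
  have : (fun q : (ι → Y) × Y => Function.update q.1 i q.2) ⁻¹' Set.univ.pi s
      = (Set.univ.pi (Function.update s i Set.univ)) ×ˢ (s i) := by
    ext q
    simp only [Set.mem_preimage, Set.mem_univ_pi, Set.mem_prod]
    constructor
    · intro h
      refine ⟨fun j => ?_, by simpa using h i⟩
      by_cases hj : j = i
      · subst hj; simp
      · simpa [hj] using h j
    · rintro ⟨h, h'⟩ j
      by_cases hj : j = i
      · subst hj; simpa
      · simpa [hj] using h j
  rw [this, Measure.prod_prod, Measure.pi_pi, ← Finset.mul_prod_erase _ _ (Finset.mem_univ i),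
    ← Finset.mul_prod_erase (a := i) _ _ (Finset.mem_univ i)]
  simp only [Function.update_self, measure_univ, one_mul]
  rw [mul_comm]
  congr 1
  refine Finset.prod_congr rfl fun j hj => ?_
  simp [Finset.ne_of_mem_erase hj]

lemma pi_map_curry (μ : Measure Y) [IsProbabilityMeasure μ] :
    (Measure.pi (fun _ : ι × κ => μ)).map (fun s i j => s (i, j)) =
      Measure.pi (fun _ : ι => Measure.pi (fun _ : κ => μ)) := by
  have h := Measure.infinitePi_map_curry (ι := ι) (κ := κ) (X := Y) (fun _ _ => μ)
  simp only [Measure.infinitePi_eq_pi] at h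
  exact h

lemma pi_sum_map_prod (μ : Measure Y) [IsProbabilityMeasure μ] :
    (Measure.pi (fun _ : ι ⊕ κ => μ)).map (fun s => (fun i => s (Sum.inl i), fun j => s (Sum.inr j)))
      = (Measure.pi (fun _ : ι => μ)).prod (Measure.pi (fun _ : κ => μ)) := by
  exact (measurePreserving_sumPiEquivProdPi (X := fun _ : ι ⊕ κ => Y) (fun _ => μ)).map_eq

end ProductMeasures

/-- Splitting a long i.i.d. sample into two families of blocks. -/
lemma iidLaw_map_blocks {X : Type u} [MeasurableSpace X] (D : Measure (X × Bool))
    [IsProbabilityMeasure D] {m r n k : ℕ} (e : (Fin r ⊕ Fin n) × Fin k → Fin m)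
    (he : Function.Injective e) :
    (iidLaw D m).map (fun S =>
      ((fun i l => S (e (Sum.inl i, l))), (fun j l => S (e (Sum.inr j, l))))) =
    (Measure.pi (fun _ : Fin r => iidLaw D k)).prod (Measure.pi (fun _ : Fin n => iidLaw D k)) := by
  have : IsProbabilityMeasure (iidLaw D k) := by unfold iidLaw; infer_instance
  rw [← pi_sum_map_prod]
  have h2 := pi_map_curry (ι := Fin r ⊕ Fin n) (κ := Fin k) D
  have h1 := pi_map_comp_injective (fun _ : Fin m => D) e he
  unfold iidLaw
  rw [← h2, ← h1, Measure.map_map (by fun_prop) (by fun_prop),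
    Measure.map_map (by fun_prop) (by fun_prop)]
  rfl

instance iidLaw_isProbabilityMeasure {X : Type u} [MeasurableSpace X] (D : Measure (X × Bool))
    [IsProbabilityMeasure D] (m : ℕ) : IsProbabilityMeasure (iidLaw D m) := by
  unfold iidLaw; infer_instance

section Modeled

variable {X : Type u} [MeasurableSpace X]

lemma measurable_coe_predictor (p : Predictor X) : Measurable (fun x => (p x : ℝ)) :=
  measurable_subtype_coe.comp p.2

lemma modeled_apply (D : Measure (X × Bool)) (p : Predictor X) {s : Set (X × Bool)}
    (hs : MeasurableSet s) :
    modeled D p s = (∫⁻ x in (fun x => (x, true)) ⁻¹' s, ENNReal.ofReal (p x) ∂(D.map Prod.fst)) +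
      ∫⁻ x in (fun x => (x, false)) ⁻¹' s, ENNReal.ofReal (1 - p x) ∂(D.map Prod.fst) := by
  unfold modeled
  rw [Measure.add_apply, Measure.map_apply (by fun_prop) hs, Measure.map_apply (by fun_prop) hs,
    withDensity_apply _ (hs.preimage (by fun_prop)), withDensity_apply _ (hs.preimage (by fun_prop))]

lemma modeled_map_fst (D : Measure (X × Bool)) (p : Predictor X) :
    (modeled D p).map Prod.fst = D.map Prod.fst := by
  ext s hs
  rw [Measure.map_apply measurable_fst hs, modeled_apply D p (measurable_fst hs)]
  have h1 : (fun x : X => (x, true)) ⁻¹' (Prod.fst ⁻¹' s) = s := rfl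
  have h2 : (fun x : X => (x, false)) ⁻¹' (Prod.fst ⁻¹' s) = s := rfl
  rw [h1, h2, ← lintegral_add_left (measurable_coe_predictor p).ennreal_ofReal]
  have : ∀ x, ENNReal.ofReal (p x) + ENNReal.ofReal (1 - p x) = 1 := by
    intro x
    rw [← ENNReal.ofReal_add (p x).2.1 (by linarith [(p x).2.2])]
    simp
  simp [this]

instance modeled_isProbabilityMeasure (D : Measure (X × Bool)) [IsProbabilityMeasure D]
    (p : Predictor X) : IsProbabilityMeasure (modeled D p) := by
  have h := modeled_map_fst D p
  have : IsProbabilityMeasure ((modeled D p).map Prod.fst) := by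
    rw [h]; exact Measure.isProbabilityMeasure_map measurable_fst.aemeasurable
  exact ⟨by simpa [Measure.map_apply measurable_fst MeasurableSet.univ] using this.measure_univ⟩

/-- A distribution is determined by its marginal and the conditional mean of the label. -/
lemma exists_modeled_eq_self (D : Measure (X × Bool)) [IsProbabilityMeasure D] :
    ∃ p : Predictor X, modeled D p = D := by
  classical
  set μ := D.map Prod.fst with hμ
  have hμp : IsProbabilityMeasure μ := Measure.isProbabilityMeasure_map measurable_fst.aemeasurable
  have hB : ∀ b : Bool, MeasurableSet (Prod.snd ⁻¹' {b} : Set (X × Bool)) := fun b =>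
    measurable_snd (measurableSet_singleton b)
  set μ₁ := (D.restrict (Prod.snd ⁻¹' {true})).map Prod.fst with hμ₁
  have hle : μ₁ ≤ μ := Measure.map_mono Measure.restrict_le_self measurable_fst
  have hfin : IsFiniteMeasure μ₁ := by rw [hμ₁]; infer_instance
  have hac : μ₁ ≪ μ := Measure.absolutelyContinuous_of_le hle
  set φ := μ₁.rnDeriv μ with hφ
  have hφm : Measurable φ := Measure.measurable_rnDeriv _ _
  have hφ1 : φ ≤ᵐ[μ] 1 := by
    refine ae_le_of_forall_setLIntegral_le_of_sigmaFinite hφm fun s hs _ => ?_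
    rw [Measure.setLIntegral_rnDeriv hac]
    simpa using hle s
  let p : Predictor X := ⟨fun x => Set.projIcc 0 1 zero_le_one (φ x).toReal,
    (continuous_projIcc.measurable).comp hφm.ennreal_toReal⟩
  have hp : ∀ᵐ x ∂μ, ENNReal.ofReal (p x) = φ x := by
    filter_upwards [hφ1] with x hx
    have hx' : φ x ≤ 1 := hx
    have h1 : (φ x).toReal ∈ Set.Icc (0 : ℝ) 1 :=
      ⟨ENNReal.toReal_nonneg, ENNReal.toReal_le_of_le_ofReal zero_le_one (by simpa using hx')⟩
    have : ((p x : unitInterval) : ℝ) = (φ x).toReal := by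
      change ((Set.projIcc (0 : ℝ) 1 zero_le_one (φ x).toReal : unitInterval) : ℝ) = _
      rw [Set.projIcc_of_mem zero_le_one h1]
    rw [this, ENNReal.ofReal_toReal (ne_top_of_le_ne_top ENNReal.one_ne_top hx')]
  have ht : ∀ s : Set X, MeasurableSet s →
      ∫⁻ x in s, ENNReal.ofReal (p x) ∂μ = D (s ×ˢ {true}) := by
    intro s hs
    rw [lintegral_congr_ae (ae_restrict_of_ae hp), Measure.setLIntegral_rnDeriv hac, hμ₁,
      Measure.map_apply measurable_fst hs, Measure.restrict_apply (measurable_fst hs)]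
    rfl
  have hf : ∀ s : Set X, MeasurableSet s →
      ∫⁻ x in s, ENNReal.ofReal (1 - p x) ∂μ = D (s ×ˢ {false}) := by
    intro s hs
    have h1 : ∫⁻ x in s, ENNReal.ofReal (p x) ∂μ + ∫⁻ x in s, ENNReal.ofReal (1 - p x) ∂μ = μ s := by
      rw [← lintegral_add_left (measurable_coe_predictor p).ennreal_ofReal]
      have : ∀ x, ENNReal.ofReal (p x) + ENNReal.ofReal (1 - p x) = 1 := by
        intro x
        rw [← ENNReal.ofReal_add (p x).2.1 (by linarith [(p x).2.2])]
        simp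
      simp [this]
    have h2 : μ s = D (s ×ˢ {true}) + D (s ×ˢ {false}) := by
      rw [hμ, Measure.map_apply measurable_fst hs, ← measure_union]
      · congr 1
        ext ⟨x, b⟩
        cases b <;> simp
      · rw [Set.disjoint_left]
        rintro ⟨x, b⟩ h h'
        simp_all
      · exact hs.prod (measurableSet_singleton _)
    rw [ht s hs, h2] at h1
    exact (ENNReal.add_right_inj (measure_ne_top _ _)).1 h1
  refine ⟨p, ?_⟩
  ext s hs
  have hst := hs.preimage (f := fun x : X => (x, true)) (by fun_prop)
  have hsf := hs.preimage (f := fun x : X => (x, false)) (by fun_prop)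
  rw [modeled_apply D p hs, ← hμ, ht _ hst, hf _ hsf, ← measure_union]
  · congr 1
    ext ⟨x, b⟩
    cases b <;> simp
  · rw [Set.disjoint_left]
    rintro ⟨x, b⟩ h h'
    simp_all
  · exact hsf.prod (measurableSet_singleton _)

/-- The label `1` is drawn with probability `p x` by comparing a uniform coin with `p x`. -/
def coinLabel (p : Predictor X) (z : X × unitInterval) : X × Bool := (z.1, decide (z.2 < p z.1))

lemma measurable_decide_lt {Z : Type*} [MeasurableSpace Z] {a b : Z → unitInterval}
    (ha : Measurable a) (hb : Measurable b) : Measurable (fun z => decide (a z < b z)) := by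
  refine measurable_to_bool ?_
  have : (fun z => decide (a z < b z)) ⁻¹' {true} = {z | a z < b z} := by ext; simp
  rw [this]
  exact measurableSet_lt ha hb

lemma measurable_coinLabel (p : Predictor X) : Measurable (coinLabel p) :=
  measurable_fst.prodMk (measurable_decide_lt measurable_snd (p.2.comp measurable_fst))

lemma modeled_eq_map_coinLabel (D : Measure (X × Bool)) [IsProbabilityMeasure D]
    (p : Predictor X) :
    modeled D p = ((D.map Prod.fst).prod (volume : Measure unitInterval)).map (coinLabel p) := by
  have hμp : IsProbabilityMeasure (D.map Prod.fst) :=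
    Measure.isProbabilityMeasure_map measurable_fst.aemeasurable
  ext s hs
  rw [modeled_apply D p hs, Measure.map_apply (measurable_coinLabel p) hs,
    Measure.prod_apply (measurable_coinLabel p hs)]
  have hst := hs.preimage (f := fun x : X => (x, true)) (by fun_prop)
  have hsf := hs.preimage (f := fun x : X => (x, false)) (by fun_prop)
  rw [← lintegral_indicator hst, ← lintegral_indicator hsf,
    ← lintegral_add_left ((measurable_coe_predictor p).ennreal_ofReal.indicator hst)]
  refine lintegral_congr fun x => ?_
  have hset : Prod.mk x ⁻¹' (coinLabel p ⁻¹' s) =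
      {t : unitInterval | t < p x ∧ (x, true) ∈ s} ∪ {t | p x ≤ t ∧ (x, false) ∈ s} := by
    ext t
    simp only [Set.mem_preimage, coinLabel, Set.mem_union, Set.mem_ofPred_eq]
    by_cases h : t < p x
    · simp [h, not_le.2 h]
    · simp [h, not_lt.1 h]
  have hl : (volume : Measure unitInterval) (Set.Iio (p x)) = ENNReal.ofReal (p x) := by simp
  have hr : (volume : Measure unitInterval) (Set.Ici (p x)) = ENNReal.ofReal (1 - p x) := by simp
  have hu : (volume : Measure unitInterval) Set.univ = 1 := measure_univ
  have hsum : ENNReal.ofReal (p x) + ENNReal.ofReal (1 - p x) = 1 := by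
    rw [← ENNReal.ofReal_add (p x).2.1 (by linarith [(p x).2.2])]
    simp
  have hT : x ∈ (fun x : X => (x, true)) ⁻¹' s ↔ (x, true) ∈ s := Iff.rfl
  have hF : x ∈ (fun x : X => (x, false)) ⁻¹' s ↔ (x, false) ∈ s := Iff.rfl
  rw [hset]
  by_cases h1 : (x, true) ∈ s <;> by_cases h0 : (x, false) ∈ s
  · have : {t : unitInterval | t < p x ∧ (x, true) ∈ s} ∪ {t | p x ≤ t ∧ (x, false) ∈ s}
        = Set.univ := by ext t; simp [h1, h0, lt_or_ge]
    rw [this, hu, Set.indicator_of_mem (hT.2 h1), Set.indicator_of_mem (hF.2 h0), hsum]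
  · rw [Set.indicator_of_mem (hT.2 h1), Set.indicator_of_notMem (mt hF.1 h0), add_zero, ← hl]
    congr 1; ext t; simp [h1, h0]
  · rw [Set.indicator_of_notMem (mt hT.1 h1), Set.indicator_of_mem (hF.2 h0), zero_add, ← hr]
    congr 1; ext t; simp [h1, h0]
  · rw [Set.indicator_of_notMem (mt hT.1 h1), Set.indicator_of_notMem (mt hF.1 h0)]
    simp [h1, h0]

lemma integral_modeled (D : Measure (X × Bool)) [IsProbabilityMeasure D] (p : Predictor X)
    {F : X × Bool → ℝ} (hF : Measurable F) {C : ℝ} (hC : ∀ z, |F z| ≤ C) :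
    ∫ z, F z ∂(modeled D p) =
      ∫ x, (p x * F (x, true) + (1 - p x) * F (x, false)) ∂(D.map Prod.fst) := by
  have hμp : IsProbabilityMeasure (D.map Prod.fst) :=
    Measure.isProbabilityMeasure_map measurable_fst.aemeasurable
  have hfin : IsFiniteMeasure (modeled D p) := inferInstance
  have hp := measurable_coe_predictor p
  have hp' : Measurable (fun x => 1 - (p x : ℝ)) := measurable_const.sub hp
  have hi : ∀ ν : Measure (X × Bool), IsFiniteMeasure ν → Integrable F ν := fun ν _ =>
    Integrable.of_bound hF.aestronglyMeasurable C (Filter.Eventually.of_forall hC)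
  have hle : ∀ ν, modeled D p = ν + ((D.map Prod.fst).withDensity
      (fun x => ENNReal.ofReal (1 - p x))).map (fun x => (x, false)) → IsFiniteMeasure ν := by
    intro ν h
    exact isFiniteMeasure_of_le (modeled D p) (by rw [h]; exact Measure.le_add_right le_rfl)
  have hf1 := hle _ rfl
  have hf2 : IsFiniteMeasure (((D.map Prod.fst).withDensity
      (fun x => ENNReal.ofReal (1 - p x))).map (fun x => (x, false))) :=
    isFiniteMeasure_of_le (modeled D p) (Measure.le_add_left le_rfl)
  unfold modeled
  rw [integral_add_measure (hi _ hf1) (hi _ hf2),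
    integral_map (by fun_prop) hF.aestronglyMeasurable,
    integral_map (by fun_prop) hF.aestronglyMeasurable,
    integral_withDensity_eq_integral_toReal_smul hp.ennreal_ofReal (by simp),
    integral_withDensity_eq_integral_toReal_smul
      hp'.ennreal_ofReal (by simp)]
  have e1 : ∀ x, (ENNReal.ofReal (p x)).toReal = p x := fun x => ENNReal.toReal_ofReal (p x).2.1
  have e2 : ∀ x, (ENNReal.ofReal (1 - p x)).toReal = 1 - p x := fun x =>
    ENNReal.toReal_ofReal (by linarith [(p x).2.2])
  simp only [e1, e2, smul_eq_mul]
  have hb : ∀ (b : Bool) (q : X → ℝ), Measurable q → (∀ x, q x ∈ Set.Icc (0 : ℝ) 1) →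
      Integrable (fun x => q x * F (x, b)) (D.map Prod.fst) := by
    intro b q hq hq1
    refine Integrable.of_bound (by fun_prop) (1 * C) (Filter.Eventually.of_forall fun x => ?_)
    rw [Real.norm_eq_abs, abs_mul, abs_of_nonneg (hq1 x).1]
    exact mul_le_mul (hq1 x).2 (hC _) (abs_nonneg _) zero_le_one
  rw [integral_add (hb true _ hp fun x => (p x).2)
    (hb false (fun x => 1 - (p x : ℝ)) (by fun_prop)
      fun x => ⟨by linarith [(p x).2.2], by linarith [(p x).2.1]⟩)]

lemma restrictTo_apply (D : Measure (X × Bool)) {g : Set X} (hg : MeasurableSet g)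
    (s : Set (X × Bool)) :
    restrictTo D g s = (D (Prod.fst ⁻¹' g))⁻¹ * D (Prod.fst ⁻¹' g ∩ s) :=
  ProbabilityTheory.cond_apply (measurable_fst hg) D s

lemma restrictTo_map_fst (D : Measure (X × Bool)) {g : Set X} (hg : MeasurableSet g) :
    (restrictTo D g).map Prod.fst = ((D.map Prod.fst) g)⁻¹ • (D.map Prod.fst).restrict g := by
  ext s hs
  rw [Measure.map_apply measurable_fst hs, restrictTo_apply D hg, Measure.smul_apply,
    Measure.restrict_apply hs, Measure.map_apply measurable_fst hg,
    Measure.map_apply measurable_fst (hs.inter hg), smul_eq_mul, Set.inter_comm s g]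
  rfl

lemma restrictTo_modeled (D : Measure (X × Bool)) (p : Predictor X)
    {g : Set X} (hg : MeasurableSet g) :
    restrictTo (modeled D p) g = modeled (restrictTo D g) p := by
  ext s hs
  have hmg : modeled D p (Prod.fst ⁻¹' g) = (D.map Prod.fst) g := by
    rw [← Measure.map_apply measurable_fst hg, modeled_map_fst]
  rw [restrictTo_apply _ hg, modeled_apply _ _ hs, hmg,
    modeled_apply _ _ ((measurable_fst hg).inter hs), restrictTo_map_fst D hg, mul_add]
  have h : ∀ (b : Bool) (F : X → ENNReal),
      ((D.map Prod.fst) g)⁻¹ * ∫⁻ x in (fun x => (x, b)) ⁻¹' (Prod.fst ⁻¹' g ∩ s), F x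
        ∂(D.map Prod.fst) =
      ∫⁻ x in (fun x => (x, b)) ⁻¹' s, F x
        ∂(((D.map Prod.fst) g)⁻¹ • (D.map Prod.fst).restrict g) := by
    intro b F
    have hsb := hs.preimage (f := fun x : X => (x, b)) (by fun_prop)
    rw [Measure.restrict_smul, lintegral_smul_measure, Measure.restrict_restrict hsb, smul_eq_mul,
      Set.inter_comm]
    rfl
  rw [h, h]

lemma isCondMean_modeled (D : Measure (X × Bool)) [IsProbabilityMeasure D] (p : Predictor X) :
    IsCondMean (modeled D p) p := by
  unfold IsCondMean
  have hm : MeasurableSpace.comap (Prod.fst : X × Bool → X) inferInstance ≤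
      (inferInstance : MeasurableSpace (X × Bool)) := measurable_fst.comap_le
  have hy : Measurable (fun z : X × Bool => if z.2 = true then (1 : ℝ) else 0) :=
    Measurable.ite (measurable_snd (measurableSet_singleton true)) measurable_const measurable_const
  have hpz : Measurable (fun z : X × Bool => (p z.1 : ℝ)) :=
    (measurable_coe_predictor p).comp measurable_fst
  refine ae_eq_condExp_of_forall_setIntegral_eq hm ?_ ?_ ?_ ?_
  · refine Integrable.of_bound hy.aestronglyMeasurable 1 (Filter.Eventually.of_forall fun z => ?_)
    split_ifs <;> simp
  · intro s _ _
    refine Integrable.of_bound hpz.aestronglyMeasurable 1 (Filter.Eventually.of_forall fun z => ?_)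
    rw [Real.norm_eq_abs, abs_of_nonneg (p z.1).2.1]
    exact (p z.1).2.2
  · rintro s ⟨t, ht, rfl⟩ _
    have hs : MeasurableSet (Prod.fst ⁻¹' t : Set (X × Bool)) := measurable_fst ht
    rw [← integral_indicator hs, ← integral_indicator hs,
      integral_modeled D p (hpz.indicator hs) (C := 1), integral_modeled D p (hy.indicator hs) (C := 1)]
    · refine integral_congr_ae (Filter.Eventually.of_forall fun x => ?_)
      by_cases hx : x ∈ t
      · simp [Set.indicator, hx]; ring
      · simp [Set.indicator, hx]
    · intro z
      by_cases hz : z.1 ∈ t <;> by_cases hz2 : z.2 = true <;> simp [Set.indicator, hz, hz2]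
    · intro z
      by_cases hz : z.1 ∈ t
      · simpa [Set.indicator, hz, abs_of_nonneg (p z.1).2.1] using (p z.1).2.2
      · simp [Set.indicator, hz]
  · refine StronglyMeasurable.aestronglyMeasurable ?_
    exact ((measurable_coe_predictor p).comp (comap_measurable Prod.fst)).stronglyMeasurable

end Modeled

section Hybrid

/-- The hybrid argument: if two product measures disagree on `B`, then exchanging a single
coordinate changes the measure of `B` by a `1/k` fraction of the disagreement. -/
lemma exists_coordinate_gap {Y : Type*} [MeasurableSpace Y] {k : ℕ} (D D' : Measure Y)
    [IsProbabilityMeasure D] [IsProbabilityMeasure D'] {B : Set (Fin k → Y)}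
    (hB : MeasurableSet B) {τ : ℝ} (hτ : 0 ≤ τ)
    (h : τ < |(Measure.pi (fun _ : Fin k => D)).real B -
      (Measure.pi (fun _ : Fin k => D')).real B|) :
    ∃ (i : Fin k) (ν : Fin k → Measure Y), (∀ j, ν j = D ∨ ν j = D') ∧
      τ / k ≤ ∫ v, |D.real {y | Function.update v i y ∈ B} -
        D'.real {y | Function.update v i y ∈ B}| ∂(Measure.pi ν) := by
  set ν : ℕ → Fin k → Measure Y := fun n j => if (j : ℕ) < n then D' else D with hν
  have hνp : ∀ n j, IsProbabilityMeasure (ν n j) := by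
    intro n j; simp only [hν]; split_ifs <;> infer_instance
  set F : ℕ → ℝ := fun n => (Measure.pi (ν n)).real B with hF
  have h0 : F 0 = (Measure.pi (fun _ : Fin k => D)).real B := by simp [hF, hν]
  have hk : F k = (Measure.pi (fun _ : Fin k => D')).real B := by simp [hF, hν]
  rw [← h0, ← hk] at h
  have hkpos : 0 < k := by
    rcases Nat.eq_zero_or_pos k with rfl | hk0
    · simp at h; linarith
    · exact hk0
  have hex : ∃ n ∈ Finset.range k, τ / k ≤ |F n - F (n + 1)| := by
    by_contra! hcon
    have h1 : F 0 - F k = ∑ n ∈ Finset.range k, (F n - F (n + 1)) :=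
      (Finset.sum_range_sub' F k).symm
    have h2 : |F 0 - F k| ≤ ∑ n ∈ Finset.range k, τ / k := by
      rw [h1]
      exact (Finset.abs_sum_le_sum_abs _ _).trans
        (Finset.sum_le_sum fun n hn => (hcon n hn).le)
    rw [Finset.sum_const, Finset.card_range, nsmul_eq_mul,
      mul_div_cancel₀ _ (by positivity)] at h2
    linarith
  obtain ⟨n, hn, hgap⟩ := hex
  have hnk := Finset.mem_range.1 hn
  refine ⟨⟨n, hnk⟩, ν n, fun j => ?_, hgap.trans ?_⟩
  · simp only [hν]; split_ifs <;> simp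
  set i : Fin k := ⟨n, hnk⟩ with hi
  have e0 : ν n = Function.update (ν n) i D := by
    ext1 j
    by_cases hj : j = i
    · subst hj; simp [hν, hi]
    · simp [hj]
  have e1 : ν (n + 1) = Function.update (ν n) i D' := by
    ext1 j
    by_cases hj : j = i
    · subst hj; simp [hν, hi]
    · have : (j : ℕ) ≠ n := fun h => hj (Fin.ext h)
      have h2 : (j : ℕ) < n + 1 ↔ (j : ℕ) < n := by omega
      simp [hj, hν, h2]
  have hm : Measurable (fun q : (Fin k → Y) × Y => Function.update q.1 i q.2) := by fun_prop
  have hS := hm hB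
  have key : ∀ (E : Measure Y) [IsProbabilityMeasure E],
      (Measure.pi (Function.update (ν n) i E)).real B =
        ∫ v, E.real {y | Function.update v i y ∈ B} ∂(Measure.pi (ν n)) ∧
      Integrable (fun v => E.real {y | Function.update v i y ∈ B}) (Measure.pi (ν n)) := by
    intro E _
    have hme : Measurable (fun v => E {y | Function.update v i y ∈ B}) :=
      measurable_measure_prodMk_left (ν := E) hS
    constructor
    · rw [measureReal_def, pi_update_eq_map, Measure.map_apply hm hB, Measure.prod_apply hS]
      simp only [measureReal_def]
      rw [integral_toReal hme.aemeasurable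
        (Filter.Eventually.of_forall fun v => measure_lt_top _ _)]
      rfl
    · refine Integrable.of_bound hme.ennreal_toReal.aestronglyMeasurable 1
        (Filter.Eventually.of_forall fun v => ?_)
      rw [Real.norm_eq_abs, abs_of_nonneg measureReal_nonneg]
      exact measureReal_le_one
  have k0 := key D
  have k1 := key D'
  simp only [hF]
  rw [e1]
  conv_lhs => rw [e0]
  rw [Function.update_idem, k0.1, k1.1, ← integral_sub k0.2 k1.2]
  exact abs_integral_le_integral_abs

end Hybrid

section Boosting

variable {X : Type u} [MeasurableSpace X] {k : ℕ}

/-- The marginal effect on the test `B` of the label of the example `x` at position `i`. -/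
def influence (B : Set (Fin k → X × Bool)) (i : Fin k) (v : Fin k → X × Bool) (x : X) : ℝ :=
  B.indicator (fun _ => 1) (Function.update v i (x, true)) -
    B.indicator (fun _ => 1) (Function.update v i (x, false))

omit [MeasurableSpace X] in
lemma abs_influence_le (B : Set (Fin k → X × Bool)) (i : Fin k) (v : Fin k → X × Bool) (x : X) :
    |influence B i v x| ≤ 1 := by
  unfold influence Set.indicator
  split_ifs <;> simp

lemma measurable_influence {Θ : Type*} [MeasurableSpace Θ] {B : Θ → Set (Fin k → X × Bool)}
    (hB : MeasurableSet {q : Θ × (Fin k → X × Bool) | q.2 ∈ B q.1}) (i : Fin k) :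
    Measurable (fun q : Θ × (Fin k → X × Bool) × X => influence (B q.1) i q.2.1 q.2.2) := by
  have h : ∀ b : Bool, Measurable (fun q : Θ × (Fin k → X × Bool) × X =>
      (B q.1).indicator (fun _ => (1 : ℝ)) (Function.update q.2.1 i (q.2.2, b))) := by
    intro b
    have h1 : Measurable ({q : Θ × (Fin k → X × Bool) | q.2 ∈ B q.1}.indicator
      (fun _ => (1 : ℝ))) := measurable_const.indicator hB
    have h2 : Measurable (fun q : Θ × (Fin k → X × Bool) × X =>
      (q.1, Function.update q.2.1 i (q.2.2, b))) := by fun_prop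
    exact h1.comp h2
  exact (h true).sub (h false)

/-- The correlation of the error of the predictor `p` with the influence of the `i`-th label. -/
def disc (μ : Measure X) (q p : Predictor X) (B : Set (Fin k → X × Bool)) (i : Fin k)
    (v : Fin k → X × Bool) : ℝ :=
  ∫ x, (q x - p x) * influence B i v x ∂μ

lemma measurableSet_update {B : Set (Fin k → X × Bool)} (hB : MeasurableSet B) (i : Fin k)
    (v : Fin k → X × Bool) : MeasurableSet {y | Function.update v i y ∈ B} := by
  have : Measurable (fun y : X × Bool => Function.update v i y) := by fun_prop
  exact this hB

lemma measurable_influence_right {B : Set (Fin k → X × Bool)} (hB : MeasurableSet B) (i : Fin k)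
    (v : Fin k → X × Bool) : Measurable (influence B i v) := by
  have h := measurable_influence (Θ := Unit) (B := fun _ => B) (measurable_snd hB) i
  have h2 : Measurable (fun x : X => ((), v, x)) := by fun_prop
  exact h.comp h2

lemma abs_sub_predictor_le (q p : Predictor X) (x : X) : |(q x : ℝ) - p x| ≤ 1 := by
  rw [abs_le]
  constructor <;> linarith [(q x).2.1, (q x).2.2, (p x).2.1, (p x).2.2]

lemma abs_disc_le (μ : Measure X) [IsProbabilityMeasure μ] (q p : Predictor X)
    (B : Set (Fin k → X × Bool)) (i : Fin k) (v : Fin k → X × Bool) : |disc μ q p B i v| ≤ 1 := by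
  have := norm_integral_le_of_norm_le_const (μ := μ) (C := 1)
    (f := fun x => ((q x : ℝ) - p x) * influence B i v x) (Filter.Eventually.of_forall fun x => by
      rw [Real.norm_eq_abs, abs_mul]
      exact mul_le_one₀ (abs_sub_predictor_le q p x) (abs_nonneg _) (abs_influence_le B i v x))
  simpa [disc] using this

lemma real_modeled_sub_real_modeled (D : Measure (X × Bool)) [IsProbabilityMeasure D]
    (q p : Predictor X) {B : Set (Fin k → X × Bool)} (hB : MeasurableSet B) (i : Fin k)
    (v : Fin k → X × Bool) :
    (modeled D q).real {y | Function.update v i y ∈ B} -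
      (modeled D p).real {y | Function.update v i y ∈ B} = disc (D.map Prod.fst) q p B i v := by
  have hμp : IsProbabilityMeasure (D.map Prod.fst) :=
    Measure.isProbabilityMeasure_map measurable_fst.aemeasurable
  have hS := measurableSet_update hB i v
  set F : X × Bool → ℝ := {y | Function.update v i y ∈ B}.indicator (fun _ => 1) with hF
  have hFm : Measurable F := measurable_const.indicator hS
  have hFb : ∀ z, |F z| ≤ 1 := by
    intro z; simp only [hF, Set.indicator]; split_ifs <;> simp
  have key : ∀ p : Predictor X, (modeled D p).real {y | Function.update v i y ∈ B} =
      ∫ x, (p x * F (x, true) + (1 - p x) * F (x, false)) ∂(D.map Prod.fst) := by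
    intro p
    rw [← integral_modeled D p hFm hFb, hF, integral_indicator hS]
    simp
  have hint : ∀ p : Predictor X, Integrable
      (fun x => (p x * F (x, true) + (1 - p x) * F (x, false))) (D.map Prod.fst) := by
    intro p
    have hp := measurable_coe_predictor p
    refine Integrable.of_bound (by fun_prop) 2 (Filter.Eventually.of_forall fun x => ?_)
    have h1 := abs_le.1 (hFb (x, true))
    have h2 := abs_le.1 (hFb (x, false))
    have h3 := (p x).2.1
    have h4 := (p x).2.2
    rw [Real.norm_eq_abs, abs_le]
    constructor <;> nlinarith
  rw [key, key, ← integral_sub (hint q) (hint p), disc]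
  refine integral_congr_ae (Filter.Eventually.of_forall fun x => ?_)
  have : influence B i v x = F (x, true) - F (x, false) := rfl
  simp only [this]
  ring

/-- The largest correlation over all the labelings of the other examples. -/
def maxDisc (μ : Measure X) (q p : Predictor X) (B : Set (Fin k → X × Bool)) (i : Fin k)
    (xs : Fin k → X) : ℝ :=
  Finset.univ.sup' Finset.univ_nonempty
    (fun b : Fin k → Bool => |disc μ q p B i (fun l => (xs l, b l))|)

lemma measurable_disc (μ : Measure X) [IsProbabilityMeasure μ] (q p : Predictor X)
    {B : Set (Fin k → X × Bool)} (hB : MeasurableSet B) (i : Fin k) :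
    Measurable (disc μ q p B i) := by
  have h := measurable_influence (Θ := Unit) (B := fun _ => B) (measurable_snd hB) i
  have h2 : Measurable (fun z : (Fin k → X × Bool) × X => ((), z.1, z.2)) := by fun_prop
  have hq := measurable_coe_predictor q
  have hp := measurable_coe_predictor p
  have h3 : Measurable (fun z : (Fin k → X × Bool) × X =>
      ((q z.2 : ℝ) - p z.2) * influence B i z.1 z.2) :=
    ((hq.comp measurable_snd).sub (hp.comp measurable_snd)).mul (h.comp h2)
  exact (h3.stronglyMeasurable.integral_prod_right (ν := μ)).measurable

lemma measurable_maxDisc (μ : Measure X) [IsProbabilityMeasure μ] (q p : Predictor X)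
    {B : Set (Fin k → X × Bool)} (hB : MeasurableSet B) (i : Fin k) :
    Measurable (maxDisc μ q p B i) := by
  unfold maxDisc
  have : Measurable (Finset.univ.sup' Finset.univ_nonempty
    (fun (b : Fin k → Bool) (xs : Fin k → X) => |disc μ q p B i (fun l => (xs l, b l))|)) := by
    refine Finset.measurable_sup' _ fun b _ => ?_
    have h2 : Measurable (fun (xs : Fin k → X) l => (xs l, b l)) := by fun_prop
    exact ((measurable_disc μ q p hB i).comp h2).abs
  convert this using 1
  ext xs
  rw [Finset.sup'_apply]

lemma abs_maxDisc_le (μ : Measure X) [IsProbabilityMeasure μ] (q p : Predictor X)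
    (B : Set (Fin k → X × Bool)) (i : Fin k) (xs : Fin k → X) : |maxDisc μ q p B i xs| ≤ 1 := by
  rw [abs_of_nonneg]
  · exact Finset.sup'_le _ _ fun b _ => abs_disc_le μ q p B i _
  · exact (abs_nonneg _).trans (Finset.le_sup' (fun b : Fin k → Bool =>
      |disc μ q p B i (fun l => (xs l, b l))|) (Finset.mem_univ fun _ => true))

/-- A predictor that a test can tell from the truth correlates with the influence of some label. -/
lemma exists_integral_maxDisc_ge (D : Measure (X × Bool)) [IsProbabilityMeasure D]
    {q : Predictor X} (hq : modeled D q = D) (p : Predictor X) {B : Set (Fin k → X × Bool)}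
    (hB : MeasurableSet B) {τ : ℝ} (hτ : 0 ≤ τ)
    (h : τ < |(iidLaw D k).real B - (iidLaw (modeled D p) k).real B|) :
    ∃ i : Fin k, τ / k ≤
      ∫ u, maxDisc (D.map Prod.fst) q p B i (fun l => (u l).1) ∂(iidLaw D k) := by
  have hμp : IsProbabilityMeasure (D.map Prod.fst) :=
    Measure.isProbabilityMeasure_map measurable_fst.aemeasurable
  obtain ⟨i, ν, hν, hle⟩ := exists_coordinate_gap D (modeled D p) hB hτ h
  have hνp : ∀ j, IsProbabilityMeasure (ν j) := by
    intro j; rcases hν j with h | h <;> rw [h] <;> infer_instance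
  refine ⟨i, hle.trans ?_⟩
  have hmap : ∀ ν : Fin k → Measure (X × Bool), (∀ j, IsProbabilityMeasure (ν j)) →
      (∀ j, (ν j).map Prod.fst = D.map Prod.fst) →
      ∫ u, maxDisc (D.map Prod.fst) q p B i (fun l => (u l).1) ∂(Measure.pi ν) =
        ∫ xs, maxDisc (D.map Prod.fst) q p B i xs
          ∂(Measure.pi (fun _ : Fin k => D.map Prod.fst)) := by
    intro ν hνp hνm
    have h1 : Measure.pi (fun _ : Fin k => D.map Prod.fst) =
        (Measure.pi ν).map (fun u l => (u l).1) := by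
      have hs : ∀ j, SigmaFinite ((ν j).map Prod.fst) := by
        intro j; rw [hνm]; infer_instance
      rw [Measure.pi_map_pi (f := fun _ => Prod.fst) (fun j => measurable_fst.aemeasurable)]
      congr 1
      ext1 j
      rw [hνm]
    rw [h1, integral_map (Measurable.aemeasurable (by fun_prop))
      (measurable_maxDisc _ q p hB i).aestronglyMeasurable]
  have e1 : ∫ u, maxDisc (D.map Prod.fst) q p B i (fun l => (u l).1) ∂(iidLaw D k) =
      ∫ u, maxDisc (D.map Prod.fst) q p B i (fun l => (u l).1) ∂(Measure.pi ν) := by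
    rw [hmap ν hνp, iidLaw, hmap _ (fun _ => inferInstance) (fun _ => rfl)]
    intro j
    rcases hν j with h | h <;> rw [h]
    exact modeled_map_fst D p
  rw [e1]
  have hm : Measurable (fun u : Fin k → X × Bool =>
      maxDisc (D.map Prod.fst) q p B i (fun l => (u l).1)) := by
    have h2 : Measurable (fun (u : Fin k → X × Bool) l => (u l).1) := by fun_prop
    exact (measurable_maxDisc _ q p hB i).comp h2
  refine integral_mono_of_nonneg (Filter.Eventually.of_forall fun v => abs_nonneg _)
    (Integrable.of_bound hm.aestronglyMeasurable 1
      (Filter.Eventually.of_forall fun u => abs_maxDisc_le _ q p B i _))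
    (Filter.Eventually.of_forall fun v => ?_)
  have : D.real {y | Function.update v i y ∈ B} -
      (modeled D p).real {y | Function.update v i y ∈ B} = disc (D.map Prod.fst) q p B i v := by
    rw [← real_modeled_sub_real_modeled D q p hB i v, hq]
  simp only [this]
  exact Finset.le_sup' (fun b : Fin k → Bool =>
    |disc (D.map Prod.fst) q p B i (fun l => ((v l).1, b l))|) (Finset.mem_univ fun l => (v l).2)

end Boosting

section Candidates

variable {X : Type u} [MeasurableSpace X] {k : ℕ} {ι : Type*}

/-- A family of tests on `k` labeled examples that depends measurably on the tested predictor. -/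
def MeasurableTests (Acc : ι → Predictor X → Set (Fin k → X × Bool)) : Prop :=
  ∀ (a : ι) (Θ : Type u) [MeasurableSpace Θ] (h : Θ → Predictor X),
    Measurable (fun q : Θ × X => h q.1 q.2) →
      MeasurableSet {q : Θ × (Fin k → X × Bool) | q.2 ∈ Acc a (h q.1)}

lemma MeasurableTests.measurableSet {Acc : ι → Predictor X → Set (Fin k → X × Bool)}
    (hAcc : MeasurableTests Acc) (a : ι) (p : Predictor X) : MeasurableSet (Acc a p) := by
  have h := hAcc a PUnit (fun _ => p) (p.2.comp measurable_snd)
  exact (measurable_prodMk_left (x := PUnit.unit)) h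

/-- The possible updates of a predictor: none, or a test, a position in the block of examples,
a relabeling of the block, and a sign. -/
abbrev Choice (ι : Type*) (k : ℕ) : Type _ := Option (ι × Fin k × (Fin k → Bool) × Bool)

/-- Move `p` in the direction of the influence of a label and clip the result. -/
def boost {Acc : ι → Predictor X → Set (Fin k → X × Bool)} (hAcc : MeasurableTests Acc) (η : ℝ)
    (p : Predictor X) (u : Fin k → X × Bool) : Choice ι k → Predictor X
  | none => p
  | some (a, i, b, s) => ⟨fun x => Set.projIcc 0 1 zero_le_one
      (p x + (if s then η else -η) * influence (Acc a p) i (fun l => ((u l).1, b l)) x), by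
      have h1 := measurable_coe_predictor p
      have h2 := measurable_influence_right (hAcc.measurableSet a p) i (fun l => ((u l).1, b l))
      exact continuous_projIcc.measurable.comp (h1.add (h2.const_mul _))⟩

lemma measurable_boost {Acc : ι → Predictor X → Set (Fin k → X × Bool)}
    (hAcc : MeasurableTests Acc) (η : ℝ) (c : Choice ι k) {Θ : Type u} [MeasurableSpace Θ]
    {h : Θ → Predictor X} (hh : Measurable (fun q : Θ × X => h q.1 q.2))
    {u : Θ → Fin k → X × Bool} (hu : Measurable u) :
    Measurable (fun q : Θ × X => boost hAcc η (h q.1) (u q.1) c q.2) := by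
  rcases c with _ | ⟨a, i, b, s⟩
  · exact hh
  · have h1 := measurable_influence (B := fun θ => Acc a (h θ)) (hAcc a Θ h hh) i
    have h2 : Measurable (fun q : Θ × X => (q.1, (fun l => ((u q.1 l).1, b l)), q.2)) := by
      fun_prop
    have h3 : Measurable (fun q : Θ × X => (h q.1 q.2 : ℝ)) := measurable_subtype_coe.comp hh
    exact (continuous_projIcc (h := zero_le_one)).measurable.comp (h3.add ((h1.comp h2).const_mul _))

/-- The predictor obtained from `p` by a sequence of updates. -/
def boostSeq {Acc : ι → Predictor X → Set (Fin k → X × Bool)} (hAcc : MeasurableTests Acc) (η : ℝ) :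
    (r : ℕ) → (Fin r → Choice ι k) → Predictor X → (Fin r → Fin k → X × Bool) → Predictor X
  | 0, _, p, _ => p
  | r + 1, c, p, us => boostSeq hAcc η r (Fin.tail c) (boost hAcc η p (us 0) (c 0)) (Fin.tail us)

lemma measurable_boostSeq {Acc : ι → Predictor X → Set (Fin k → X × Bool)}
    (hAcc : MeasurableTests Acc) (η : ℝ) (r : ℕ) (c : Fin r → Choice ι k)
    {Θ : Type u} [MeasurableSpace Θ] {h : Θ → Predictor X}
    (hh : Measurable (fun q : Θ × X => h q.1 q.2))
    {us : Θ → Fin r → Fin k → X × Bool} (hu : Measurable us) :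
    Measurable (fun q : Θ × X => boostSeq hAcc η r c (h q.1) (us q.1) q.2) := by
  induction r generalizing h with
  | zero => exact hh
  | succ r ih =>
    have h1 : Measurable (fun q : Θ × X => boost hAcc η (h q.1) (us q.1 0) (c 0) q.2) :=
      measurable_boost hAcc η (c 0) hh (u := fun θ => us θ 0) ((measurable_pi_apply 0).comp hu)
    have h2 : Measurable (fun θ => Fin.tail (us θ)) :=
      measurable_pi_lambda _ fun j => (measurable_pi_apply j.succ).comp hu
    exact ih (Fin.tail c) (h := fun θ => boost hAcc η (h θ) (us θ 0) (c 0)) h1 h2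

lemma boostSeq_none {Acc : ι → Predictor X → Set (Fin k → X × Bool)} (hAcc : MeasurableTests Acc)
    (η : ℝ) (r : ℕ) (p : Predictor X) (us : Fin r → Fin k → X × Bool) :
    boostSeq hAcc η r (fun _ => none) p us = p := by
  induction r with
  | zero => rfl
  | succ r ih => exact ih (Fin.tail us)

/-- The probability that the test `B` accepts when the labels are redrawn according to `p`. -/
def relabelProb (p : Predictor X) (B : Set (Fin k → X × Bool)) (s : Fin k → X × Bool) : ℝ :=
  (volume : Measure (Fin k → unitInterval)).real
    {t | (fun l => coinLabel p ((s l).1, t l)) ∈ B}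

lemma measurable_relabelProb {Acc : ι → Predictor X → Set (Fin k → X × Bool)}
    (hAcc : MeasurableTests Acc) (a : ι) {Θ : Type u} [MeasurableSpace Θ] {h : Θ → Predictor X}
    (hh : Measurable (fun q : Θ × X => h q.1 q.2)) :
    Measurable (fun q : Θ × (Fin k → X × Bool) => relabelProb (h q.1) (Acc a (h q.1)) q.2) := by
  have h1 : Measurable (fun z : (Θ × (Fin k → X × Bool)) × (Fin k → unitInterval) =>
      (z.1.1, fun l => coinLabel (h z.1.1) ((z.1.2 l).1, z.2 l))) := by
    refine (measurable_fst.comp measurable_fst).prodMk (measurable_pi_lambda _ fun l => ?_)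
    refine Measurable.prodMk (by fun_prop) (measurable_decide_lt (by fun_prop) ?_)
    have h2 : Measurable (fun z : (Θ × (Fin k → X × Bool)) × (Fin k → unitInterval) =>
      (z.1.1, (z.1.2 l).1)) := by fun_prop
    exact hh.comp h2
  have h3 := h1 (hAcc a Θ h hh)
  exact (measurable_measure_prodMk_left (ν := volume) h3).ennreal_toReal

lemma relabelProb_mem (p : Predictor X) (B : Set (Fin k → X × Bool)) (s : Fin k → X × Bool) :
    relabelProb p B s ∈ Set.Icc (0 : ℝ) 1 :=
  ⟨measureReal_nonneg, measureReal_le_one⟩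

lemma MeasurableTests.measurable_relabelProb {Acc : ι → Predictor X → Set (Fin k → X × Bool)}
    (hAcc : MeasurableTests Acc) (a : ι) (p : Predictor X) :
    Measurable (relabelProb p (Acc a p)) := by
  have h := MultiGroup.measurable_relabelProb hAcc a (Θ := PUnit) (h := fun _ => p)
    (p.2.comp measurable_snd)
  exact h.comp (measurable_prodMk_left (x := PUnit.unit))

lemma iidLaw_modeled_real (D : Measure (X × Bool)) [IsProbabilityMeasure D] (p : Predictor X)
    {B : Set (Fin k → X × Bool)} (hB : MeasurableSet B) :
    (iidLaw (modeled D p) k).real B = ∫ s, relabelProb p B s ∂(iidLaw D k) := by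
  have hμp : IsProbabilityMeasure (D.map Prod.fst) :=
    Measure.isProbabilityMeasure_map measurable_fst.aemeasurable
  set μ := D.map Prod.fst with hμ
  have hcm : Measurable (fun z : (Fin k → X) × (Fin k → unitInterval) =>
      fun l => coinLabel p (z.1 l, z.2 l)) :=
    measurable_pi_lambda _ fun l => (measurable_coinLabel p).comp (by fun_prop)
  have e1 : iidLaw (modeled D p) k = ((Measure.pi (fun _ : Fin k => μ)).prod
      (Measure.pi (fun _ : Fin k => (volume : Measure unitInterval)))).map
        (fun z l => coinLabel p (z.1 l, z.2 l)) := by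
    have h1 := (measurePreserving_arrowProdEquivProdArrow X unitInterval (Fin k)
      (fun _ => μ) (fun _ => volume)).map_eq
    rw [← h1, Measure.map_map hcm (MeasurableEquiv.measurable _), iidLaw,
      modeled_eq_map_coinLabel D p, ← hμ]
    have hs : ∀ j : Fin k, SigmaFinite ((μ.prod (volume : Measure unitInterval)).map
        (coinLabel p)) := by
      intro j
      have := Measure.isProbabilityMeasure_map (μ := μ.prod (volume : Measure unitInterval))
        (measurable_coinLabel p).aemeasurable
      infer_instance
    rw [← Measure.pi_map_pi (fun j => (measurable_coinLabel p).aemeasurable)]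
    rfl
  have e2 : Measure.pi (fun _ : Fin k => μ) = (iidLaw D k).map (fun u l => (u l).1) := by
    have hs : ∀ j : Fin k, SigmaFinite (D.map Prod.fst) := by
      intro j; rw [← hμ]; infer_instance
    rw [iidLaw, Measure.pi_map_pi (f := fun _ => Prod.fst) (fun j => measurable_fst.aemeasurable)]
  have hS := hcm hB
  have hme := measurable_measure_prodMk_left
    (ν := Measure.pi (fun _ : Fin k => (volume : Measure unitInterval))) hS
  have hfst : Measurable (fun (u : Fin k → X × Bool) l => (u l).1) := by fun_prop
  rw [measureReal_def, e1, Measure.map_apply hcm hB, Measure.prod_apply hS, e2,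
    lintegral_map hme hfst]
  simp only [relabelProb, measureReal_def]
  rw [integral_toReal]
  · rfl
  · exact (hme.comp hfst).aemeasurable
  · exact Filter.Eventually.of_forall fun v => measure_lt_top _ _

/-- The difference of the acceptance probabilities under the truth and under the model `p`. -/
def gap (D : Measure (X × Bool)) (p : Predictor X) (B : Set (Fin k → X × Bool)) : ℝ :=
  (iidLaw D k).real B - (iidLaw (modeled D p) k).real B

/-- The contribution of one block of examples to the empirical estimate of the gap. -/
def gapSample (p : Predictor X) (B : Set (Fin k → X × Bool)) (s : Fin k → X × Bool) : ℝ :=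
  B.indicator (fun _ => 1) s - relabelProb p B s

lemma gapSample_mem (p : Predictor X) (B : Set (Fin k → X × Bool)) (s : Fin k → X × Bool) :
    gapSample p B s ∈ Set.Icc (-1 : ℝ) 1 := by
  have h := relabelProb_mem p B s
  unfold gapSample Set.indicator
  constructor <;> split_ifs <;> linarith [h.1, h.2]

lemma measurable_gapSample {Acc : ι → Predictor X → Set (Fin k → X × Bool)}
    (hAcc : MeasurableTests Acc) (a : ι) {Θ : Type u} [MeasurableSpace Θ] {h : Θ → Predictor X}
    (hh : Measurable (fun q : Θ × X => h q.1 q.2)) :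
    Measurable (fun q : Θ × (Fin k → X × Bool) => gapSample (h q.1) (Acc a (h q.1)) q.2) := by
  have h1 : Measurable ({q : Θ × (Fin k → X × Bool) | q.2 ∈ Acc a (h q.1)}.indicator
      (fun _ => (1 : ℝ))) := measurable_const.indicator (hAcc a Θ h hh)
  exact h1.sub (measurable_relabelProb hAcc a hh)

lemma MeasurableTests.measurable_gapSample {Acc : ι → Predictor X → Set (Fin k → X × Bool)}
    (hAcc : MeasurableTests Acc) (a : ι) (p : Predictor X) :
    Measurable (gapSample p (Acc a p)) :=
  (measurable_const.indicator (hAcc.measurableSet a p)).sub (hAcc.measurable_relabelProb a p)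

lemma MeasurableTests.integral_gapSample {Acc : ι → Predictor X → Set (Fin k → X × Bool)}
    (hAcc : MeasurableTests Acc) (a : ι) (D : Measure (X × Bool)) [IsProbabilityMeasure D]
    (p : Predictor X) : ∫ s, gapSample p (Acc a p) s ∂(iidLaw D k) = gap D p (Acc a p) := by
  have hB := hAcc.measurableSet a p
  unfold gapSample gap
  rw [integral_sub, iidLaw_modeled_real D p hB, integral_indicator hB]
  · simp
  · exact (integrable_const (1 : ℝ)).indicator hB
  · refine Integrable.of_bound (hAcc.measurable_relabelProb a p).aestronglyMeasurable 1
      (Filter.Eventually.of_forall fun s => ?_)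
    rw [Real.norm_eq_abs, abs_of_nonneg (relabelProb_mem _ _ s).1]
    exact (relabelProb_mem _ _ s).2

lemma measurable_gap {Acc : ι → Predictor X → Set (Fin k → X × Bool)}
    (hAcc : MeasurableTests Acc) (a : ι) (D : Measure (X × Bool)) [IsProbabilityMeasure D]
    {Θ : Type u} [MeasurableSpace Θ] {h : Θ → Predictor X}
    (hh : Measurable (fun q : Θ × X => h q.1 q.2)) :
    Measurable (fun θ => gap D (h θ) (Acc a (h θ))) := by
  have h1 := ((measurable_gapSample hAcc a hh).stronglyMeasurable.integral_prod_right'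
    (ν := iidLaw D k)).measurable
  convert h1 using 1
  ext θ
  exact (hAcc.integral_gapSample a D (h θ)).symm

end Candidates

section Progress

variable {X : Type u} [MeasurableSpace X] {k : ℕ} {ι : Type*}

/-- The mean squared distance of the predictor `p` to the conditional mean `q`. -/
def sqDist (μ : Measure X) (q p : Predictor X) : ℝ := ∫ x, ((q x : ℝ) - p x) ^ 2 ∂μ

lemma sqDist_nonneg (μ : Measure X) (q p : Predictor X) : 0 ≤ sqDist μ q p :=
  integral_nonneg fun _ => sq_nonneg _

lemma integrable_sq_sub (μ : Measure X) [IsProbabilityMeasure μ] (q p : Predictor X) :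
    Integrable (fun x => ((q x : ℝ) - p x) ^ 2) μ := by
  have hq := measurable_coe_predictor q
  have hp := measurable_coe_predictor p
  refine Integrable.of_bound (by fun_prop) 1 (Filter.Eventually.of_forall fun x => ?_)
  rw [Real.norm_eq_abs, abs_pow]
  exact pow_le_one₀ (abs_nonneg _) (abs_sub_predictor_le q p x)

lemma sqDist_le_one (μ : Measure X) [IsProbabilityMeasure μ] (q p : Predictor X) :
    sqDist μ q p ≤ 1 := by
  have := integral_mono (μ := μ) (integrable_sq_sub μ q p) (integrable_const (1 : ℝ)) fun x => by
    have h := pow_le_one₀ (n := 2) (abs_nonneg _) (abs_sub_predictor_le q p x)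
    rwa [← abs_pow, abs_of_nonneg (sq_nonneg _)] at h
  simpa [sqDist] using this

lemma sq_sub_projIcc_le {a : ℝ} (ha : a ∈ Set.Icc (0 : ℝ) 1) (z : ℝ) :
    (a - (Set.projIcc (0 : ℝ) 1 zero_le_one z : ℝ)) ^ 2 ≤ (a - z) ^ 2 := by
  rw [Set.coe_projIcc]
  obtain ⟨h0, h1⟩ := ha
  rcases le_total z 0 with hz | hz
  · rw [max_eq_left (by simp [hz])]
    nlinarith
  · rcases le_total z 1 with hz1 | hz1
    · simp [hz, hz1]
    · simp [hz1]
      nlinarith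

/-- Some update along the influence of a label decreases the squared distance by the amount of the
correlation with that influence. -/
lemma exists_sqDist_boost_le {Acc : ι → Predictor X → Set (Fin k → X × Bool)}
    (hAcc : MeasurableTests Acc) (η : ℝ) (μ : Measure X) [IsProbabilityMeasure μ]
    (q p : Predictor X) (a : ι) (i : Fin k) (u : Fin k → X × Bool) :
    ∃ c : Choice ι k, sqDist μ q (boost hAcc η p u c) ≤
      sqDist μ q p - 2 * η * maxDisc μ q p (Acc a p) i (fun l => (u l).1) + η ^ 2 := by
  have hB := hAcc.measurableSet a p
  obtain ⟨b, -, hb⟩ := Finset.exists_mem_eq_sup' Finset.univ_nonempty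
    (fun b : Fin k → Bool => |disc μ q p (Acc a p) i (fun l => ((u l).1, b l))|)
  have hmax : maxDisc μ q p (Acc a p) i (fun l => (u l).1) =
    |disc μ q p (Acc a p) i (fun l => ((u l).1, b l))| := hb
  set v : Fin k → X × Bool := fun l => ((u l).1, b l) with hv
  have key : ∀ s : Bool, sqDist μ q (boost hAcc η p u (some (a, i, b, s))) ≤
      sqDist μ q p - 2 * (if s then η else -η) * disc μ q p (Acc a p) i v + η ^ 2 := by
    intro s
    set σ : ℝ := if s then η else -η with hσ
    have hσ2 : σ ^ 2 = η ^ 2 := by rw [hσ]; split_ifs <;> ring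
    have hq := measurable_coe_predictor q
    have hp := measurable_coe_predictor p
    have hi := measurable_influence_right hB i v
    have hdi : Integrable (fun x => ((q x : ℝ) - p x) * influence (Acc a p) i v x) μ := by
      refine Integrable.of_bound (by fun_prop) 1 (Filter.Eventually.of_forall fun x => ?_)
      rw [Real.norm_eq_abs, abs_mul]
      exact mul_le_one₀ (abs_sub_predictor_le q p x) (abs_nonneg _) (abs_influence_le _ i v x)
    have hle : ∀ x, ((q x : ℝ) - boost hAcc η p u (some (a, i, b, s)) x) ^ 2 ≤
        ((q x : ℝ) - p x) ^ 2 - 2 * σ * (((q x : ℝ) - p x) * influence (Acc a p) i v x) +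
          η ^ 2 := by
      intro x
      have h1 := sq_sub_projIcc_le (q x).2 ((p x : ℝ) + σ * influence (Acc a p) i v x)
      have h2 : influence (Acc a p) i v x ^ 2 ≤ 1 := by
        have := pow_le_one₀ (n := 2) (abs_nonneg _) (abs_influence_le (Acc a p) i v x)
        rwa [sq_abs] at this
      have h3 : σ ^ 2 * influence (Acc a p) i v x ^ 2 ≤ η ^ 2 := by
        rw [hσ2]
        exact mul_le_of_le_one_right (sq_nonneg _) h2
      have h4 : (boost hAcc η p u (some (a, i, b, s)) x : ℝ) =
        (Set.projIcc (0 : ℝ) 1 zero_le_one ((p x : ℝ) + σ * influence (Acc a p) i v x) : ℝ) := rfl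
      rw [h4]
      nlinarith
    have hint := ((integrable_sq_sub μ q p).sub (hdi.const_mul (2 * σ))).add
      (integrable_const (η ^ 2))
    refine (integral_mono (integrable_sq_sub μ q _) hint hle).trans (le_of_eq ?_)
    have e1 := integral_add (μ := μ) ((integrable_sq_sub μ q p).sub (hdi.const_mul (2 * σ)))
      (integrable_const (η ^ 2))
    have e2 := integral_sub (μ := μ) (integrable_sq_sub μ q p) (hdi.const_mul (2 * σ))
    simp only [Pi.add_apply, Pi.sub_apply] at e1 ⊢
    rw [e1, e2, integral_const_mul]
    simp [sqDist, disc]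
  rcases le_total 0 (disc μ q p (Acc a p) i v) with h | h
  · refine ⟨some (a, i, b, true), (key true).trans (le_of_eq ?_)⟩
    rw [hmax, abs_of_nonneg h]
    simp
  · refine ⟨some (a, i, b, false), (key false).trans (le_of_eq ?_)⟩
    rw [hmax, abs_of_nonpos h]
    simp

/-- No sequence of updates of `p` based on the blocks `us` leads to a predictor that is
indistinguishable up to `τ`. -/
def AllFail {Acc : ι → Predictor X → Set (Fin k → X × Bool)} (hAcc : MeasurableTests Acc) (η : ℝ)
    (D : Measure (X × Bool)) (τ : ℝ) (r : ℕ) (p : Predictor X) (us : Fin r → Fin k → X × Bool) :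
    Prop :=
  ∀ c : Fin r → Choice ι k, ∃ a,
    τ < |gap D (boostSeq hAcc η r c p us) (Acc a (boostSeq hAcc η r c p us))|

variable [Fintype ι]

lemma measurableSet_allFail {Acc : ι → Predictor X → Set (Fin k → X × Bool)}
    (hAcc : MeasurableTests Acc) (η : ℝ) (D : Measure (X × Bool)) [IsProbabilityMeasure D]
    (τ : ℝ) (r : ℕ) (p : Predictor X) : MeasurableSet {us | AllFail hAcc η D τ r p us} := by
  simp only [AllFail, Set.ofPred_forall, Set.ofPred_exists]
  refine MeasurableSet.iInter fun c => MeasurableSet.iUnion fun a => ?_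
  have h := measurable_boostSeq hAcc η r c (Θ := Fin r → Fin k → X × Bool) (h := fun _ => p)
    (p.2.comp measurable_snd) (us := id) measurable_id
  exact measurableSet_lt measurable_const
    (measurable_gap hAcc a D (h := fun us => boostSeq hAcc η r c p us) h).abs

/-- The probability that boosting fails is inversely proportional to the number of rounds. -/
theorem allFail_measureReal_le {Acc : ι → Predictor X → Set (Fin k → X × Bool)}
    (hAcc : MeasurableTests Acc) (D : Measure (X × Bool)) [IsProbabilityMeasure D]
    {q : Predictor X} (hq : modeled D q = D) {τ : ℝ} (hτ : 0 ≤ τ) (r : ℕ) (p : Predictor X) :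
    (r : ℝ) * (τ / k) ^ 2 * (Measure.pi (fun _ : Fin r => iidLaw D k)).real
      {us | AllFail hAcc (τ / k) D τ r p us} ≤ sqDist (D.map Prod.fst) q p := by
  have hμp : IsProbabilityMeasure (D.map Prod.fst) :=
    Measure.isProbabilityMeasure_map measurable_fst.aemeasurable
  set μ := D.map Prod.fst with hμ
  set η := τ / k with hη
  have hη0 : 0 ≤ η := by positivity
  induction r generalizing p with
  | zero => simpa using sqDist_nonneg μ q p
  | succ r ih =>
    by_cases hp : ∀ a, |gap D p (Acc a p)| ≤ τ
    · have : {us | AllFail hAcc η D τ (r + 1) p us} = ∅ := by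
        ext us
        simp only [Set.mem_ofPred_eq, Set.mem_empty_iff_false, iff_false]
        intro h
        obtain ⟨a, ha⟩ := h fun _ => none
        rw [boostSeq_none] at ha
        exact absurd (hp a) (not_le.2 ha)
      rw [this]
      simpa using sqDist_nonneg μ q p
    · push Not at hp
      obtain ⟨a, ha⟩ := hp
      obtain ⟨i, hi⟩ := exists_integral_maxDisc_ge D hq p (hAcc.measurableSet a p) hτ ha
      rw [← hη, ← hμ] at hi
      set P := Measure.pi (fun _ : Fin r => iidLaw D k) with hP
      set S := {us | AllFail hAcc η D τ (r + 1) p us} with hS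
      have hSm : MeasurableSet S := measurableSet_allFail hAcc η D τ (r + 1) p
      set N : (Fin k → X × Bool) → ℝ := fun u => P.real {us | Fin.cons u us ∈ S} with hN
      have hmp := (measurePreserving_piFinSuccAbove
        (fun _ : Fin (r + 1) => iidLaw D k) 0).symm
      have hT : MeasurableSet {z : (Fin k → X × Bool) × (Fin r → Fin k → X × Bool) |
          (Fin.cons z.1 z.2 : Fin (r + 1) → Fin k → X × Bool) ∈ S} := by
        have : Measurable (fun z : (Fin k → X × Bool) × (Fin r → Fin k → X × Bool) =>
            (Fin.cons z.1 z.2 : Fin (r + 1) → Fin k → X × Bool)) := by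
          refine measurable_pi_lambda _ fun j => ?_
          refine Fin.cases ?_ (fun j => ?_) j
          · exact measurable_fst
          · exact (measurable_pi_apply j).comp measurable_snd
        exact this hSm
      have hme := measurable_measure_prodMk_left (ν := P) hT
      have hfub : (Measure.pi (fun _ : Fin (r + 1) => iidLaw D k)).real S =
          ∫ u, N u ∂(iidLaw D k) := by
        rw [measureReal_def, ← hmp.measure_preimage hSm.nullMeasurableSet]
        have e : (⇑(MeasurableEquiv.piFinSuccAbove (fun _ : Fin (r + 1) => Fin k → X × Bool)
            0).symm ⁻¹' S) = {z | (Fin.cons z.1 z.2 : Fin (r + 1) → Fin k → X × Bool) ∈ S} := by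
          ext z
          simp [MeasurableEquiv.piFinSuccAbove, Fin.insertNthEquiv]
        rw [e, Measure.prod_apply hT]
        simp only [hN, measureReal_def]
        exact (integral_toReal hme.aemeasurable
          (Filter.Eventually.of_forall fun v => measure_lt_top _ _)).symm
      have hNi : Integrable N (iidLaw D k) := by
        refine Integrable.of_bound hme.ennreal_toReal.aestronglyMeasurable 1
          (Filter.Eventually.of_forall fun v => ?_)
        rw [Real.norm_eq_abs, abs_of_nonneg measureReal_nonneg]
        exact measureReal_le_one
      have hstep : ∀ u, (r : ℝ) * η ^ 2 * N u ≤
          sqDist μ q p - 2 * η * maxDisc μ q p (Acc a p) i (fun l => (u l).1) + η ^ 2 := by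
        intro u
        obtain ⟨c, hc⟩ := exists_sqDist_boost_le hAcc η μ q p a i u
        refine le_trans ?_ ((ih (boost hAcc η p u c)).trans hc)
        refine mul_le_mul_of_nonneg_left (measureReal_mono ?_) (by positivity)
        intro us hus c'
        have := hus (Fin.cons c c')
        simpa [boostSeq] using this
      have hMi : Integrable (fun u : Fin k → X × Bool =>
          maxDisc μ q p (Acc a p) i (fun l => (u l).1)) (iidLaw D k) := by
        have h2 : Measurable (fun (u : Fin k → X × Bool) l => (u l).1) := by fun_prop
        exact Integrable.of_bound ((measurable_maxDisc μ q p
          (hAcc.measurableSet a p) i).comp h2).aestronglyMeasurable 1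
          (Filter.Eventually.of_forall fun u => abs_maxDisc_le _ q p _ i _)
      have hI : (r : ℝ) * η ^ 2 * ∫ u, N u ∂(iidLaw D k) ≤ sqDist μ q p - 2 * η *
          ∫ u, maxDisc μ q p (Acc a p) i (fun l => (u l).1) ∂(iidLaw D k) + η ^ 2 := by
        have h1 := ((integrable_const (μ := iidLaw D k) (sqDist μ q p)).sub
          (hMi.const_mul (2 * η)))
        have h := integral_mono (hNi.const_mul ((r : ℝ) * η ^ 2))
          (h1.add (integrable_const (η ^ 2))) hstep
        have e1 := integral_add h1 (integrable_const (μ := iidLaw D k) (η ^ 2))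
        have e2 := integral_sub (integrable_const (μ := iidLaw D k) (sqDist μ q p))
          (hMi.const_mul (2 * η))
        simp only [Pi.add_apply, Pi.sub_apply] at e1 h
        rw [e1, e2, integral_const_mul, integral_const_mul] at h
        simpa using h
      have hN1 : ∫ u, N u ∂(iidLaw D k) ≤ 1 := by rw [← hfub]; exact measureReal_le_one
      rw [hfub]
      push_cast
      have h3 : 2 * η * η ≤ 2 * η *
          ∫ u, maxDisc μ q p (Acc a p) i (fun l => (u l).1) ∂(iidLaw D k) :=
        mul_le_mul_of_nonneg_left hi (by positivity)
      have h4 : η ^ 2 * ∫ u, N u ∂(iidLaw D k) ≤ η ^ 2 :=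
        mul_le_of_le_one_right (sq_nonneg _) hN1
      nlinarith

end Progress

/-- Two-sided Hoeffding inequality for i.i.d. variables with values in `[-1,1]`. -/
lemma pi_measureReal_abs_sum_sub_ge_le {Y : Type*} [MeasurableSpace Y] (μ : Measure Y)
    [IsProbabilityMeasure μ] {φ : Y → ℝ} (hφ : Measurable φ)
    (hb : ∀ y, φ y ∈ Set.Icc (-1 : ℝ) 1) (n : ℕ) {t : ℝ} (ht : 0 ≤ t) :
    (Measure.pi (fun _ : Fin n => μ)).real
      {s | n * t ≤ |∑ j, φ (s j) - n * ∫ y, φ y ∂μ|} ≤ 2 * Real.exp (-(n * t ^ 2 / 2)) := by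
  have key : ∀ ψ : Y → ℝ, Measurable ψ → (∀ y, ψ y ∈ Set.Icc (-1 : ℝ) 1) →
      (Measure.pi (fun _ : Fin n => μ)).real {s | n * t ≤ ∑ j, (ψ (s j) - ∫ y, ψ y ∂μ)} ≤
        Real.exp (-(n * t ^ 2 / 2)) := by
    intro ψ hψ hψb
    have hsub := ProbabilityTheory.hasSubgaussianMGF_of_mem_Icc hψ.aemeasurable
      (Filter.Eventually.of_forall hψb : ∀ᵐ y ∂μ, ψ y ∈ Set.Icc (-1 : ℝ) 1)
    have hind : ProbabilityTheory.iIndepFun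
        (fun (i : Fin n) (s : Fin n → Y) => ψ (s i) - ∫ y, ψ y ∂μ)
        (Measure.pi (fun _ : Fin n => μ)) :=
      ProbabilityTheory.iIndepFun_pi (X := fun _ y => ψ y - ∫ y, ψ y ∂μ)
        fun i => (hψ.sub_const _).aemeasurable
    have hs : ∀ i ∈ (Finset.univ : Finset (Fin n)), ProbabilityTheory.HasSubgaussianMGF
        (fun s : Fin n → Y => ψ (s i) - ∫ y, ψ y ∂μ) 1 (Measure.pi (fun _ : Fin n => μ)) := by
      intro i _
      have hmp := measurePreserving_eval (fun _ : Fin n => μ) i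
      have h1 : (‖(1 : ℝ) - -1‖₊ / 2) ^ 2 = 1 := by
        have : ‖(1 : ℝ) - -1‖₊ = 2 := by
          ext; norm_num
        rw [this]; norm_num
      rw [h1, ← hmp.map_eq] at hsub
      have := ProbabilityTheory.HasSubgaussianMGF.of_map hmp.measurable.aemeasurable hsub
      have he : ∫ x, ψ x ∂(Measure.pi (fun _ : Fin n => μ)).map (Function.eval i) = ∫ y, ψ y ∂μ := by
        rw [hmp.map_eq]
      rw [he] at this
      exact this
    have h := ProbabilityTheory.HasSubgaussianMGF.measure_sum_ge_le_of_iIndepFun hind hs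
      (ε := n * t) (by positivity)
    refine h.trans (le_of_eq ?_)
    congr 1
    rcases Nat.eq_zero_or_pos n with rfl | hn
    · simp
    · have : (n : ℝ) ≠ 0 := by positivity
      simp only [Finset.sum_const, Finset.card_univ, Fintype.card_fin, nsmul_eq_mul]
      push_cast
      field_simp
  have h1 := key φ hφ hb
  have h2 := key (fun y => -φ y) hφ.neg fun y => ⟨by linarith [(hb y).2], by linarith [(hb y).1]⟩
  have hsub : {s : Fin n → Y | n * t ≤ |∑ j, φ (s j) - n * ∫ y, φ y ∂μ|} ⊆
      {s | n * t ≤ ∑ j, (φ (s j) - ∫ y, φ y ∂μ)} ∪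
        {s | n * t ≤ ∑ j, (-φ (s j) - ∫ y, -φ y ∂μ)} := by
    intro s hs
    have e1 : ∑ j, (φ (s j) - ∫ y, φ y ∂μ) = ∑ j, φ (s j) - n * ∫ y, φ y ∂μ := by
      simp [Finset.sum_sub_distrib]
    have e2 : ∑ j, (-φ (s j) - ∫ y, -φ y ∂μ) = -(∑ j, φ (s j) - n * ∫ y, φ y ∂μ) := by
      rw [← e1, ← Finset.sum_neg_distrib, integral_neg]
      exact Finset.sum_congr rfl fun j _ => by ring
    rcases le_abs.1 (show n * t ≤ |∑ j, φ (s j) - n * ∫ y, φ y ∂μ| from hs) with h | h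
    · left; exact h.trans_eq e1.symm
    · right; exact h.trans_eq e2.symm
  calc _ ≤ _ := measureReal_mono hsub
    _ ≤ _ := measureReal_union_le _ _
    _ ≤ _ := by linarith

section Selection

variable {X : Type u} [MeasurableSpace X] {k : ℕ} {ι : Type*} [Fintype ι]

/-- Some empirical estimate of the gap of some candidate is off by `t`. -/
def TestsFail {Acc : ι → Predictor X → Set (Fin k → X × Bool)} (hAcc : MeasurableTests Acc)
    (η : ℝ) (D : Measure (X × Bool)) (t : ℝ) (r n : ℕ) (p : Predictor X)
    (z : (Fin r → Fin k → X × Bool) × (Fin n → Fin k → X × Bool)) : Prop :=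
  ∃ (c : Fin r → Choice ι k) (a : ι), n * t ≤
    |∑ j, gapSample (boostSeq hAcc η r c p z.1) (Acc a (boostSeq hAcc η r c p z.1)) (z.2 j) -
      n * gap D (boostSeq hAcc η r c p z.1) (Acc a (boostSeq hAcc η r c p z.1))|

lemma testsFail_measure_le {Acc : ι → Predictor X → Set (Fin k → X × Bool)}
    (hAcc : MeasurableTests Acc) (η : ℝ) (D : Measure (X × Bool)) [IsProbabilityMeasure D]
    {t : ℝ} (ht : 0 ≤ t) (r n : ℕ) (p : Predictor X) :
    ((Measure.pi (fun _ : Fin r => iidLaw D k)).prod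
      (Measure.pi (fun _ : Fin n => iidLaw D k))).real {z | TestsFail hAcc η D t r n p z} ≤
    (Fintype.card (Choice ι k)) ^ r * Fintype.card ι * (2 * Real.exp (-(n * t ^ 2 / 2))) := by
  set P := (Measure.pi (fun _ : Fin r => iidLaw D k)).prod
    (Measure.pi (fun _ : Fin n => iidLaw D k)) with hP
  set E : (Fin r → Choice ι k) × ι →
      Set ((Fin r → Fin k → X × Bool) × (Fin n → Fin k → X × Bool)) := fun ca =>
    {z | n * t ≤ |∑ j, gapSample (boostSeq hAcc η r ca.1 p z.1)
        (Acc ca.2 (boostSeq hAcc η r ca.1 p z.1)) (z.2 j) -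
      n * gap D (boostSeq hAcc η r ca.1 p z.1) (Acc ca.2 (boostSeq hAcc η r ca.1 p z.1))|} with hE
  have hU : {z | TestsFail hAcc η D t r n p z} = ⋃ ca, E ca := by
    ext z
    simp only [TestsFail, hE, Set.mem_iUnion, Prod.exists]
    rfl
  have hone : ∀ ca, P.real (E ca) ≤ 2 * Real.exp (-(n * t ^ 2 / 2)) := by
    rintro ⟨c, a⟩
    have hbs := measurable_boostSeq hAcc η r c (Θ := Fin r → Fin k → X × Bool) (h := fun _ => p)
      (p.2.comp measurable_snd) (us := id) measurable_id
    have hm1 : Measurable (fun us => gap D (boostSeq hAcc η r c p us)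
        (Acc a (boostSeq hAcc η r c p us))) :=
      measurable_gap hAcc a D (h := fun us => boostSeq hAcc η r c p us) hbs
    have hm2 := measurable_gapSample hAcc a (h := fun us => boostSeq hAcc η r c p us) hbs
    have hm3 : Measurable (fun z : (Fin r → Fin k → X × Bool) × (Fin n → Fin k → X × Bool) =>
        ∑ j, gapSample (boostSeq hAcc η r c p z.1) (Acc a (boostSeq hAcc η r c p z.1)) (z.2 j)) := by
      refine Finset.measurable_sum _ fun j _ => ?_
      have : Measurable (fun z : (Fin r → Fin k → X × Bool) × (Fin n → Fin k → X × Bool) =>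
        (z.1, z.2 j)) := by fun_prop
      exact hm2.comp this
    have hEm : MeasurableSet (E (c, a)) := measurableSet_le measurable_const
      (hm3.sub (measurable_const.mul (hm1.comp measurable_fst))).abs
    rw [measureReal_def, hP, Measure.prod_apply hEm]
    refine ENNReal.toReal_le_of_le_ofReal (by positivity) ?_
    calc _ ≤ ∫⁻ us, ENNReal.ofReal (2 * Real.exp (-(n * t ^ 2 / 2)))
          ∂(Measure.pi (fun _ : Fin r => iidLaw D k)) := by
          refine lintegral_mono fun us => ?_
          rw [ENNReal.le_ofReal_iff_toReal_le (measure_ne_top _ _) (by positivity)]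
          have h := pi_measureReal_abs_sum_sub_ge_le (iidLaw D k)
            (hAcc.measurable_gapSample a (boostSeq hAcc η r c p us))
            (fun s => gapSample_mem _ _ s) n ht
          rw [hAcc.integral_gapSample] at h
          exact h
      _ = _ := by simp
  rw [hU]
  calc _ ≤ ∑ ca, P.real (E ca) := measureReal_iUnion_fintype_le _
    _ ≤ ∑ _ca : (Fin r → Choice ι k) × ι, 2 * Real.exp (-(n * t ^ 2 / 2)) :=
        Finset.sum_le_sum fun ca _ => hone ca
    _ = _ := by
        rw [Finset.sum_const, Finset.card_univ, Fintype.card_prod, Fintype.card_pi]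
        simp

open Classical in
/-- Select a candidate all of whose empirical gaps are at most `3τ/4`. -/
def boostLearner {Acc : ι → Predictor X → Set (Fin k → X × Bool)} (hAcc : MeasurableTests Acc)
    (η τ : ℝ) (r n : ℕ) (p : Predictor X)
    (z : (Fin r → Fin k → X × Bool) × (Fin n → Fin k → X × Bool)) : Predictor X :=
  if h : ∃ c : Fin r → Choice ι k, ∀ a,
      |∑ j, gapSample (boostSeq hAcc η r c p z.1) (Acc a (boostSeq hAcc η r c p z.1)) (z.2 j)| ≤
        n * (3 * τ / 4) then boostSeq hAcc η r h.choose p z.1 else p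

lemma boostLearner_gap_le {Acc : ι → Predictor X → Set (Fin k → X × Bool)}
    (hAcc : MeasurableTests Acc) (η : ℝ) (D : Measure (X × Bool))
    {τ : ℝ} {r n : ℕ} (hn : 0 < n) (p : Predictor X)
    {z : (Fin r → Fin k → X × Bool) × (Fin n → Fin k → X × Bool)}
    (h1 : ¬ AllFail hAcc η D (τ / 2) r p z.1) (h2 : ¬ TestsFail hAcc η D (τ / 4) r n p z) (a : ι) :
    |gap D (boostLearner hAcc η τ r n p z) (Acc a (boostLearner hAcc η τ r n p z))| ≤ τ := by
  simp only [AllFail, not_forall, not_exists, not_lt] at h1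
  simp only [TestsFail, not_exists, not_le] at h2
  obtain ⟨c, hc⟩ := h1
  have hn' : (0 : ℝ) < n := by exact_mod_cast hn
  have hex : ∃ c : Fin r → Choice ι k, ∀ a,
      |∑ j, gapSample (boostSeq hAcc η r c p z.1) (Acc a (boostSeq hAcc η r c p z.1)) (z.2 j)| ≤
        n * (3 * τ / 4) := by
    refine ⟨c, fun a => ?_⟩
    have e1 := abs_lt.1 (h2 c a)
    have e2 := abs_le.1 (hc a)
    rw [abs_le]
    constructor <;> nlinarith
  rw [boostLearner, dif_pos hex]
  have e1 := abs_lt.1 (h2 hex.choose a)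
  have e2 := abs_le.1 (hex.choose_spec a)
  rw [abs_le]
  constructor <;> by_contra! hcon <;> nlinarith

theorem boostLearner_fail_measure_le {Acc : ι → Predictor X → Set (Fin k → X × Bool)}
    (hAcc : MeasurableTests Acc) (D : Measure (X × Bool)) [IsProbabilityMeasure D]
    {τ δ₁ δ₂ : ℝ} (hτ : 0 < τ) (hk : 0 < k) {r n : ℕ} (hn : 0 < n) (p : Predictor X)
    (hδ₁ : 1 ≤ δ₁ * (r * (τ / 2 / k) ^ 2))
    (hδ₂ : (Fintype.card (Choice ι k)) ^ r * Fintype.card ι *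
      (2 * Real.exp (-(n * (τ / 4) ^ 2 / 2))) ≤ δ₂) :
    ((Measure.pi (fun _ : Fin r => iidLaw D k)).prod (Measure.pi (fun _ : Fin n => iidLaw D k)))
      {z | ¬ ∀ a, |gap D (boostLearner hAcc (τ / 2 / k) τ r n p z)
        (Acc a (boostLearner hAcc (τ / 2 / k) τ r n p z))| ≤ τ} ≤
      ENNReal.ofReal (δ₁ + δ₂) := by
  have hμp : IsProbabilityMeasure (D.map Prod.fst) :=
    Measure.isProbabilityMeasure_map measurable_fst.aemeasurable
  obtain ⟨q, hq⟩ := exists_modeled_eq_self D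
  set P := (Measure.pi (fun _ : Fin r => iidLaw D k)).prod
    (Measure.pi (fun _ : Fin n => iidLaw D k)) with hP
  set η := τ / 2 / k with hη
  set A : Set ((Fin r → Fin k → X × Bool) × (Fin n → Fin k → X × Bool)) :=
    Prod.fst ⁻¹' {us | AllFail hAcc η D (τ / 2) r p us} with hA
  set B := {z | TestsFail hAcc η D (τ / 4) r n p z} with hB
  have hsub : {z | ¬ ∀ a, |gap D (boostLearner hAcc η τ r n p z)
      (Acc a (boostLearner hAcc η τ r n p z))| ≤ τ} ⊆ A ∪ B := by
    intro z hz
    by_contra hcon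
    rw [Set.mem_union, not_or] at hcon
    exact hz fun a => boostLearner_gap_le hAcc η D hn p hcon.1 hcon.2 a
  have hA1 : P.real A ≤ δ₁ := by
    have h := allFail_measureReal_le hAcc D hq (τ := τ / 2) (by positivity) r p
    have h' := h.trans (sqDist_le_one (D.map Prod.fst) q p)
    rw [← hη] at h'
    have hAm := measurableSet_allFail hAcc η D (τ / 2) r p
    have e : P.real A = (Measure.pi (fun _ : Fin r => iidLaw D k)).real
        {us | AllFail hAcc η D (τ / 2) r p us} := by
      have hmp : MeasurePreserving Prod.fst P (Measure.pi (fun _ : Fin r => iidLaw D k)) :=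
        measurePreserving_fst
      rw [measureReal_def, hA, hmp.measure_preimage hAm.nullMeasurableSet]
      rfl
    rw [e]
    set v := (Measure.pi (fun _ : Fin r => iidLaw D k)).real
        {us | AllFail hAcc η D (τ / 2) r p us}
    have hpos : 0 < (r : ℝ) * η ^ 2 := by
      have h0 : 0 ≤ (r : ℝ) * η ^ 2 := by positivity
      rcases h0.eq_or_lt with h0 | h0
      · rw [← h0] at hδ₁; simp at hδ₁; linarith
      · exact h0
    by_contra! hcon
    have := mul_lt_mul_of_pos_left hcon hpos
    linarith
  have hB1 : P.real B ≤ δ₂ :=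
    (testsFail_measure_le hAcc η D (t := τ / 4) (by positivity) r n p).trans hδ₂
  have hδ : 0 ≤ δ₁ + δ₂ := add_nonneg (measureReal_nonneg.trans hA1) (measureReal_nonneg.trans hB1)
  rw [ENNReal.le_ofReal_iff_toReal_le (measure_ne_top _ _) hδ]
  calc _ ≤ P.real (A ∪ B) := measureReal_mono hsub
    _ ≤ _ := measureReal_union_le _ _
    _ ≤ _ := add_le_add hA1 hB1

end Selection

section Subsample

variable {X : Type u} [MeasurableSpace X] {k : ℕ}

open Classical in
/-- The positions of the examples that fall in the group `g`. -/
def groupIndices (g : Set X) (s : Fin k → X × Bool) : Finset (Fin k) :=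
  Finset.univ.filter (fun i => (s i).1 ∈ g)

/-- The examples at the positions `J`, in increasing order. -/
def subsample (J : Finset (Fin k)) (s : Fin k → X × Bool) : Fin J.card → X × Bool :=
  fun j => s (J.orderEmbOfFin rfl j)

lemma measurable_subsample (J : Finset (Fin k)) :
    Measurable (subsample J : (Fin k → X × Bool) → Fin J.card → X × Bool) := by
  unfold subsample; fun_prop

omit [MeasurableSpace X] in
open Classical in
lemma setOf_groupIndices_eq (g : Set X) (J : Finset (Fin k)) :
    {s : Fin k → X × Bool | groupIndices g s = J} =
      Set.univ.pi (fun i => if i ∈ J then Prod.fst ⁻¹' g else (Prod.fst ⁻¹' g)ᶜ) := by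
  ext s
  simp only [Set.mem_ofPred_eq, Set.mem_univ_pi, groupIndices, Finset.ext_iff, Finset.mem_filter,
    Finset.mem_univ, true_and]
  refine forall_congr' fun i => ?_
  by_cases hi : i ∈ J <;> simp [hi]

lemma measurableSet_groupIndices_eq {g : Set X} (hg : MeasurableSet g) (J : Finset (Fin k)) :
    MeasurableSet {s : Fin k → X × Bool | groupIndices g s = J} := by
  classical
  rw [setOf_groupIndices_eq]
  refine MeasurableSet.univ_pi fun i => ?_
  split_ifs
  · exact measurable_fst hg
  · exact (measurable_fst hg).compl

lemma empiricalOn_eq_empirical (J : Finset (Fin k)) (s : Fin k → X × Bool) :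
    empiricalOn J s = empirical (subsample J s) := by
  unfold empirical empiricalOn subsample
  rw [Finset.card_univ, Fintype.card_fin]
  congr 1
  have h := Finset.sum_map Finset.univ (J.orderEmbOfFin rfl).toEmbedding
    (fun i => Measure.dirac (s i))
  have hJ : Finset.univ.map (J.orderEmbOfFin rfl).toEmbedding = J := by
    ext i; simp
  rw [hJ] at h
  exact h

lemma empiricalOn_isProbabilityMeasure {J : Finset (Fin k)} (hJ : J.Nonempty)
    (s : Fin k → X × Bool) : IsProbabilityMeasure (empiricalOn J s) := by
  refine ⟨?_⟩
  have h0 : (J.card : ENNReal) ≠ 0 := by simpa using hJ.ne_empty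
  simp only [empiricalOn, Measure.smul_apply, Measure.finsetSum_apply, measure_univ, smul_eq_mul,
    Finset.sum_const, nsmul_eq_mul, mul_one]
  exact ENNReal.inv_mul_cancel h0 (ENNReal.natCast_ne_top _)

lemma ae_empiricalOn_of_forall [MeasurableSingletonClass X] (J : Finset (Fin k))
    (s : Fin k → X × Bool) {P : X × Bool → Prop} (hP : ∀ i ∈ J, P (s i)) :
    ∀ᵐ z ∂(empiricalOn J s), P z := by
  rw [ae_iff]
  simp only [empiricalOn, Measure.smul_apply, Measure.finsetSum_apply, smul_eq_mul]
  rw [Finset.sum_eq_zero, mul_zero]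
  intro i hi
  rw [Measure.dirac_apply]
  simp [hP i hi]

/-- Conditioning a product measure on a box. -/
lemma cond_pi_univ_pi {ι Y : Type*} [Fintype ι] [MeasurableSpace Y] (E : Measure Y)
    [IsProbabilityMeasure E] {C : ι → Set Y} (hC : ∀ i, MeasurableSet (C i))
    (h0 : ∀ i, E (C i) ≠ 0) :
    ProbabilityTheory.cond (Measure.pi (fun _ : ι => E)) (Set.univ.pi C) =
      Measure.pi (fun i => ProbabilityTheory.cond E (C i)) := by
  have hp : ∀ i, IsProbabilityMeasure (ProbabilityTheory.cond E (C i)) := fun i =>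
    ProbabilityTheory.cond_isProbabilityMeasure (h0 i)
  symm
  refine Measure.pi_eq fun s hs => ?_
  rw [ProbabilityTheory.cond_apply (MeasurableSet.univ_pi hC), ← Set.pi_inter_distrib,
    Measure.pi_pi, Measure.pi_pi, ENNReal.prod_inv_distrib, ← Finset.prod_mul_distrib]
  · refine Finset.prod_congr rfl fun i _ => ?_
    rw [ProbabilityTheory.cond_apply (hC i)]
  · intro i _ j _ _
    exact Or.inl (h0 i)

/-- The subsample that falls in a group behaves like an i.i.d. sample from the distribution
conditioned on that group. -/
lemma iidLaw_subsample_le (E : Measure (X × Bool)) [IsProbabilityMeasure E] {g : Set X}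
    (hg : MeasurableSet g) {m₀ : ℕ} (hm₀ : 0 < m₀) {bad : (n : ℕ) → Set (Fin n → X × Bool)}
    (hbad : ∀ n, 0 < n → MeasurableSet (bad n)) {b : ENNReal}
    (hb : ∀ n, m₀ ≤ n → iidLaw (restrictTo E g) n (bad n) ≤ b) :
    iidLaw E k {s | m₀ ≤ (groupIndices g s).card ∧
      subsample (groupIndices g s) s ∈ bad (groupIndices g s).card} ≤ b := by
  classical
  have hgm : MeasurableSet (Prod.fst ⁻¹' g : Set (X × Bool)) := measurable_fst hg
  have hone : ∀ J : Finset (Fin k), m₀ ≤ J.card →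
      iidLaw E k ({s | groupIndices g s = J} ∩ {s | subsample J s ∈ bad J.card}) ≤
        iidLaw E k {s | groupIndices g s = J} * b := by
    intro J hJ
    set C : Fin k → Set (X × Bool) :=
      fun i => if i ∈ J then Prod.fst ⁻¹' g else (Prod.fst ⁻¹' g)ᶜ with hC
    have hCm : ∀ i, MeasurableSet (C i) := by
      intro i; simp only [hC]; split_ifs
      · exact hgm
      · exact hgm.compl
    rw [setOf_groupIndices_eq, ← hC]
    by_cases h0 : iidLaw E k (Set.univ.pi C) = 0
    · rw [h0, zero_mul]
      exact (measure_mono_null Set.inter_subset_left h0).le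
    have h0' : ∀ i, E (C i) ≠ 0 := by
      intro i hi
      apply h0
      rw [iidLaw, Measure.pi_pi]
      exact Finset.prod_eq_zero (Finset.mem_univ i) hi
    have hp : ∀ i, IsProbabilityMeasure (ProbabilityTheory.cond E (C i)) := fun i =>
      ProbabilityTheory.cond_isProbabilityMeasure (h0' i)
    rw [← ProbabilityTheory.cond_mul_eq_inter (MeasurableSet.univ_pi hCm), mul_comm]
    gcongr
    rw [iidLaw, cond_pi_univ_pi E hCm h0']
    refine le_trans (le_of_eq ?_) (hb J.card hJ)
    have hmap := pi_map_comp_injective (fun i => ProbabilityTheory.cond E (C i))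
      (fun j : Fin J.card => J.orderEmbOfFin rfl j) (J.orderEmbOfFin rfl).injective
    have hC' : (fun j : Fin J.card =>
        ProbabilityTheory.cond E (C (J.orderEmbOfFin rfl j))) = fun _ => restrictTo E g := by
      ext1 j
      simp only [hC, restrictTo]
      rw [if_pos (Finset.orderEmbOfFin_mem J rfl j)]
    have hmb := hbad J.card (hm₀.trans_le hJ)
    rw [iidLaw, ← hC', ← hmap]
    exact (Measure.map_apply (measurable_subsample J) hmb).symm
  have hsub : {s : Fin k → X × Bool | m₀ ≤ (groupIndices g s).card ∧
      subsample (groupIndices g s) s ∈ bad (groupIndices g s).card} ⊆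
      ⋃ J ∈ Finset.univ.filter (fun J : Finset (Fin k) => m₀ ≤ J.card),
        ({s | groupIndices g s = J} ∩ {s | subsample J s ∈ bad J.card}) := by
    rintro s ⟨h1, h2⟩
    simp only [Set.mem_iUnion]
    exact ⟨groupIndices g s, by simpa using h1, rfl, h2⟩
  have hdisj : ∑ J : Finset (Fin k), iidLaw E k {s | groupIndices g s = J} ≤ 1 := by
    have h := measure_biUnion_finset (μ := iidLaw E k) (s := Finset.univ)
      (f := fun J : Finset (Fin k) => {s : Fin k → X × Bool | groupIndices g s = J})
      (by
        intro J _ J' _ hJ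
        rw [Function.onFun, Set.disjoint_left]
        intro s hs hs'
        exact hJ (hs.symm.trans hs'))
      (fun J _ => measurableSet_groupIndices_eq hg J)
    rw [← h]
    exact prob_le_one
  calc _ ≤ _ := measure_mono hsub
    _ ≤ _ := measure_biUnion_finset_le _ _
    _ ≤ ∑ J ∈ Finset.univ.filter (fun J : Finset (Fin k) => m₀ ≤ J.card),
        iidLaw E k {s | groupIndices g s = J} * b :=
        Finset.sum_le_sum fun J hJ => hone J (Finset.mem_filter.1 hJ).2
    _ ≤ ∑ J : Finset (Fin k), iidLaw E k {s | groupIndices g s = J} * b :=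
        Finset.sum_le_sum_of_subset (Finset.filter_subset _ _)
    _ = (∑ J : Finset (Fin k), iidLaw E k {s | groupIndices g s = J}) * b :=
        (Finset.sum_mul _ _ _).symm
    _ ≤ 1 * b := by gcongr
    _ = b := one_mul b

/-- A large sample contains many examples of a group of non-negligible mass. -/
lemma iidLaw_card_groupIndices_lt_le (E : Measure (X × Bool)) [IsProbabilityMeasure E] {g : Set X}
    (hg : MeasurableSet g) {m₀ : ℕ} (hm₀ : 1 ≤ m₀)
    (hk : 10 * (m₀ : ℝ) ≤ k * E.real (Prod.fst ⁻¹' g)) :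
    (iidLaw E k).real {s | (groupIndices g s).card < m₀} ≤ 1 / 8 := by
  classical
  have hgm : MeasurableSet (Prod.fst ⁻¹' g : Set (X × Bool)) := measurable_fst hg
  set w := E.real (Prod.fst ⁻¹' g) with hw
  set ξ : X × Bool → ℝ := (Prod.fst ⁻¹' g).indicator (fun _ => 1) with hξ
  have hξm : Measurable ξ := measurable_const.indicator hgm
  have hξL : MemLp ξ 2 E := MemLp.of_bound hξm.aestronglyMeasurable 1
    (Filter.Eventually.of_forall fun z => by simp only [hξ, Set.indicator]; split_ifs <;> simp)
  have hξE : ∫ z, ξ z ∂E = w := by rw [hξ, integral_indicator hgm]; simp [hw]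
  have hvar : ProbabilityTheory.variance ξ E ≤ w := by
    refine (ProbabilityTheory.variance_le_expectation_sq hξm.aestronglyMeasurable).trans
      (le_of_eq ?_)
    rw [← hξE]
    refine integral_congr_ae (Filter.Eventually.of_forall fun z => ?_)
    simp only [hξ, Set.indicator, Pi.pow_apply]
    split_ifs <;> simp
  set N : (Fin k → X × Bool) → ℝ := fun s => ∑ i, ξ (s i) with hN
  have hNcard : ∀ s, N s = (groupIndices g s).card := by
    intro s
    simp only [hN, hξ, groupIndices, Set.indicator, Set.mem_preimage]
    rw [Finset.sum_ite]
    simp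
  have hNL : MemLp N 2 (iidLaw E k) := by
    have := memLp_finsetSum (μ := iidLaw E k) (p := 2) Finset.univ
      (f := fun (i : Fin k) (s : Fin k → X × Bool) => ξ (s i)) fun i _ =>
        hξL.comp_measurePreserving (measurePreserving_eval (fun _ : Fin k => E) i)
    exact this
  have hNE : ∫ s, N s ∂(iidLaw E k) = k * w := by
    simp only [hN]
    rw [integral_finsetSum]
    · have : ∀ i : Fin k, ∫ s, ξ (s i) ∂(iidLaw E k) = w := by
        intro i
        rw [← hξE]
        have hmp := measurePreserving_eval (fun _ : Fin k => E) i
        conv_rhs => rw [← hmp.map_eq]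
        rw [integral_map (measurable_pi_apply i).aemeasurable hξm.aestronglyMeasurable]
        rfl
      simp [this]
    · intro i _
      exact ((hξL.comp_measurePreserving
        (measurePreserving_eval (fun _ : Fin k => E) i)).integrable one_le_two)
  have hNV : ProbabilityTheory.variance N (iidLaw E k) ≤ k * w := by
    have h := ProbabilityTheory.variance_sum_pi (μ := fun _ : Fin k => E)
      (X := fun _ => ξ) (fun _ => hξL)
    have e : N = ∑ i, fun s : Fin k → X × Bool => ξ (s i) := by
      ext s; simp [hN]
    rw [e, iidLaw, h]
    calc _ ≤ ∑ _i : Fin k, w := Finset.sum_le_sum fun i _ => hvar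
      _ = _ := by simp
  have hm₀' : (1 : ℝ) ≤ m₀ := by exact_mod_cast hm₀
  set M := (k : ℝ) * w with hM
  have hc : 0 < 9 / 10 * M := by linarith
  have hsub : {s : Fin k → X × Bool | (groupIndices g s).card < m₀} ⊆
      {s | 9 / 10 * M ≤ |N s - ∫ s, N s ∂(iidLaw E k)|} := by
    intro s hs
    have h1 : N s < m₀ := by
      rw [hNcard]; exact_mod_cast (show (groupIndices g s).card < m₀ from hs)
    change 9 / 10 * M ≤ |N s - ∫ s, N s ∂(iidLaw E k)|
    rw [hNE, abs_sub_comm]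
    exact le_trans (by linarith) (le_abs_self _)
  have hch := ProbabilityTheory.meas_ge_le_variance_div_sq hNL hc
  have hle : (iidLaw E k) {s | (groupIndices g s).card < m₀} ≤
      ENNReal.ofReal (ProbabilityTheory.variance N (iidLaw E k) / (9 / 10 * M) ^ 2) :=
    (measure_mono hsub).trans hch
  have hle' := ENNReal.toReal_le_of_le_ofReal
    (div_nonneg (ProbabilityTheory.variance_nonneg _ _) (sq_nonneg _)) hle
  refine hle'.trans ?_
  rw [div_le_div_iff₀ (by positivity) (by norm_num)]
  nlinarith

end Subsample

section GroupTests

variable {X : Type u} [MeasurableSpace X] {k : ℕ}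

/-- The samples on which the distinguisher `A_{g,h}` accepts the predictor `p`. -/
def groupTest (L : Loss X) (f : X × unitInterval → unitInterval) (hf : Measurable f) (k : ℕ)
    (α : ℝ) (g : Set X) (h p : Predictor X) : Set (Fin k → X × Bool) :=
  {s | (groupIndices g s).Nonempty → L.risk (empiricalOn (groupIndices g s) s)
    (localPredictor f hf p) ≤ L.risk (empiricalOn (groupIndices g s) s) h + 2 * α}

lemma acceptProb_groupDistinguisher [MeasurableSingletonClass X] (L : Loss X)
    (f : X × unitInterval → unitInterval) (hf : Measurable f) (α : ℝ) (g : Set X)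
    (h p : Predictor X) (D : Measure (X × Bool)) :
    acceptProb D (groupDistinguisher L f k α g h) p =
      (iidLaw D k).real (groupTest L f hf k α g h p) := by
  unfold acceptProb
  congr 1
  ext s
  simp only [Set.mem_ofPred_eq, groupDistinguisher, groupTest]
  change ((groupIndices g s).Nonempty → L.risk (empiricalOn (groupIndices g s) s)
    (samplePredictor (fun i => (s i).1) (fun i => f ((s i).1, p (s i).1))) ≤ _) ↔ _
  refine forall_congr' fun hI => ?_
  have := empiricalOn_isProbabilityMeasure hI s
  have hae : ∀ᵐ z ∂(empiricalOn (groupIndices g s) s),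
      samplePredictor (fun i => (s i).1) (fun i => f ((s i).1, p (s i).1)) z.1 =
        localPredictor f hf p z.1 := by
    refine ae_empiricalOn_of_forall (groupIndices g s) s fun i _ => ?_
    have hex : ∃ j, (s j).1 = (s i).1 := ⟨i, rfl⟩
    simp only [samplePredictor, localPredictor]
    rw [dif_pos hex, hex.choose_spec]
  rw [L.risk_congr _ _ _ hae]
  rfl

lemma measurable_comp_snd {A B C E : Type*} [MeasurableSpace A] [MeasurableSpace B]
    [MeasurableSpace C] [MeasurableSpace E] {F : A → B → E}
    (hF : Measurable (fun q : A × B => F q.1 q.2)) {e : C → B} (he : Measurable e) :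
    Measurable (fun q : A × C => F q.1 (e q.2)) :=
  hF.comp (measurable_fst.prodMk (he.comp measurable_snd))

lemma Loss.measurable_risk_empiricalOn (L : Loss X) {J : Finset (Fin k)} (hJ : J.Nonempty)
    {Θ : Type u} [MeasurableSpace Θ] {h : Θ → Predictor X}
    (hh : Measurable (fun q : Θ × X => h q.1 q.2)) :
    Measurable (fun q : Θ × (Fin k → X × Bool) => L.risk (empiricalOn J q.2) (h q.1)) := by
  have h1 := L.measurable_risk Θ h hh J.card (Finset.card_pos.2 hJ)
  have e : (fun q : Θ × (Fin k → X × Bool) => L.risk (empiricalOn J q.2) (h q.1)) =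
      fun q => L.risk (empirical (subsample J q.2)) (h q.1) := by
    funext q
    rw [empiricalOn_eq_empirical]
  rw [e]
  exact measurable_comp_snd (F := fun θ s => L.risk (empirical s) (h θ)) h1
    (measurable_subsample J)

lemma measurableSet_groupTest (L : Loss X) (f : X × unitInterval → unitInterval)
    (hf : Measurable f) (α : ℝ) {g : Set X} (hg : MeasurableSet g) (h : Predictor X)
    {Θ : Type u} [MeasurableSpace Θ] {p : Θ → Predictor X}
    (hp : Measurable (fun q : Θ × X => p q.1 q.2)) :
    MeasurableSet {q : Θ × (Fin k → X × Bool) | q.2 ∈ groupTest L f hf k α g h (p q.1)} := by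
  have e : {q : Θ × (Fin k → X × Bool) | q.2 ∈ groupTest L f hf k α g h (p q.1)} =
      ⋃ J : Finset (Fin k), (Prod.snd ⁻¹' {s | groupIndices g s = J} ∩
        {q | J.Nonempty → L.risk (empiricalOn J q.2) (localPredictor f hf (p q.1)) ≤
          L.risk (empiricalOn J q.2) h + 2 * α}) := by
    ext q
    simp only [Set.mem_iUnion]
    constructor
    · intro hq
      exact ⟨groupIndices g q.2, rfl, hq⟩
    · rintro ⟨J, hJ, hq⟩
      have hJ' : groupIndices g q.2 = J := hJ
      subst hJ'
      exact hq
  rw [e]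
  refine MeasurableSet.iUnion fun J =>
    (measurable_snd (measurableSet_groupIndices_eq hg J)).inter ?_
  by_cases hJ : J.Nonempty
  · simp only [hJ, true_imp_iff]
    refine measurableSet_le (L.measurable_risk_empiricalOn hJ (h := fun θ =>
      localPredictor f hf (p θ)) (hf.comp (measurable_snd.prodMk hp)))
      ((L.measurable_risk_empiricalOn hJ (h := fun _ : Θ => h)
        (h.2.comp measurable_snd)).add_const _)
  · simp [hJ]

lemma Loss.measurableSet_deviation (L : Loss X) (H : Finset (Predictor X))
    (D : Measure (X × Bool)) (ε : ℝ) {n : ℕ} (hn : 0 < n) :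
    MeasurableSet {S : Fin n → X × Bool |
      ¬ ∀ h ∈ H, |L.risk (empirical S) h - L.risk D h| ≤ ε} := by
  have e : {S : Fin n → X × Bool | ¬ ∀ h ∈ H, |L.risk (empirical S) h - L.risk D h| ≤ ε} =
      ⋃ h ∈ H, {S | ε < |L.risk (empirical S) h - L.risk D h|} := by
    ext S; simp
  rw [e]
  refine H.measurableSet_biUnion fun h _ => measurableSet_lt measurable_const ?_
  have h1 := L.measurable_risk PUnit (fun _ => h) (h.2.comp measurable_snd) n hn
  have h2 := h1.comp (measurable_prodMk_left (x := PUnit.unit))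
  exact ((h2.sub_const _).abs : _)

/-- On all but few samples, uniform convergence holds on the subsample of the group `g`. -/
lemma iidLaw_group_deviation_le {L : Loss X} {mUC : ℝ → ℝ → ℕ → ℕ}
    (hUC : HasUniformConvergence L mUC) {ε δ : ℝ} (hε : ε ∈ Set.Ioo (0 : ℝ) 1)
    (hδ : δ ∈ Set.Ioo (0 : ℝ) 1) (H : Finset (Predictor X)) (E : Measure (X × Bool))
    [IsProbabilityMeasure E] {g : Set X} (hg : MeasurableSet g)
    (hk : 10 * (mUC ε δ H.card : ℝ) ≤ k * E.real (Prod.fst ⁻¹' g)) :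
    (iidLaw E k).real {s | ¬ ((groupIndices g s).Nonempty ∧ ∀ h ∈ H,
      |L.risk (empiricalOn (groupIndices g s) s) h - L.risk (restrictTo E g) h| ≤ ε)} ≤
      1 / 8 + δ := by
  have hm := hUC.1 ε hε δ hδ H.card
  set m₀ := mUC ε δ H.card with hm₀
  have hpos : E (Prod.fst ⁻¹' g) ≠ 0 := by
    intro h0
    have hm' : (1 : ℝ) ≤ m₀ := by exact_mod_cast hm
    rw [measureReal_def, h0] at hk
    simp at hk
    linarith
  have hp : IsProbabilityMeasure (restrictTo E g) :=
    ProbabilityTheory.cond_isProbabilityMeasure hpos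
  have h1 := iidLaw_card_groupIndices_lt_le E hg hm hk
  have h2 := iidLaw_subsample_le (k := k) E hg hm
    (bad := fun n => {S | ¬ ∀ h ∈ H, |L.risk (empirical S) h - L.risk (restrictTo E g) h| ≤ ε})
    (fun n hn => L.measurableSet_deviation H _ ε hn) (b := ENNReal.ofReal δ)
    (fun n hn => hUC.2.1 ε hε δ hδ H (restrictTo E g) n hn)
  have h2' := ENNReal.toReal_le_of_le_ofReal hδ.1.le h2
  refine le_trans (measureReal_mono ?_) ((measureReal_union_le _ _).trans (add_le_add h1 h2'))
  intro s hs
  by_cases hc : (groupIndices g s).card < m₀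
  · exact Or.inl hc
  · right
    rw [not_lt] at hc
    refine ⟨hc, ?_⟩
    intro hgood
    refine hs ⟨Finset.card_pos.1 (hm.trans hc), fun h hh => ?_⟩
    rw [empiricalOn_eq_empirical]
    exact hgood h hh

lemma exists_predictor_superset [Nonempty X] (H : Finset (Predictor X)) (p : Predictor X) :
    ∃ H' : Finset (Predictor X), H ⊆ H' ∧ p ∈ H' ∧ H'.card = H.card + 1 := by
  classical
  by_cases hp : p ∈ H
  · have hI : Infinite unitInterval := (Set.Icc_infinite (zero_lt_one' ℝ)).to_subtype
    have hinf : Infinite (Predictor X) := by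
      refine Infinite.of_injective (fun t : unitInterval =>
        (⟨fun _ => t, measurable_const⟩ : Predictor X)) fun t t' h => ?_
      have := congrArg Subtype.val h
      exact congrFun this (Classical.arbitrary X)
    obtain ⟨p', hp'⟩ := Infinite.exists_notMem_finset H
    exact ⟨insert p' H, Finset.subset_insert _ _, Finset.mem_insert_of_mem hp,
      Finset.card_insert_of_notMem hp'⟩
  · exact ⟨insert p H, Finset.subset_insert _ _, Finset.mem_insert_self _ _,
      Finset.card_insert_of_notMem hp⟩

/-- Outcome indistinguishability with respect to the tests `A_{g,h}` implies competitiveness. -/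
theorem isMultiGroupCompetitive_of_isOutcomeIndist [MeasurableSingletonClass X] {L : Loss X}
    {f : X × unitInterval → unitInterval} {hf : Measurable f} (hproper : IsProper L f hf)
    {mUC : ℝ → ℝ → ℕ → ℕ} (hUC : HasUniformConvergence L mUC) {ε δ γ : ℝ}
    (hε : ε ∈ Set.Ioo (0 : ℝ) 1) (hδ : δ ∈ Set.Ioo (0 : ℝ) 1) (hγ : γ ∈ Set.Ioo (0 : ℝ) 1)
    (H : Finset (Predictor X)) (G : Finset (Set X)) (hG : ∀ g ∈ G, MeasurableSet g)
    (D : Measure (X × Bool)) [IsProbabilityMeasure D] (p : Predictor X)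
    (hp : IsOutcomeIndist D
      (groupDistinguishers L f (distinguisherSize mUC ε δ γ H.card) (ε / 4) H G) (δ / 4) p) :
    IsMultiGroupCompetitive L D ε γ H G (localPredictor f hf p) := by
  intro g hgG hgγ h hh
  have hg := hG g hgG
  by_contra! hcon
  have hX : Nonempty X := by
    have : Nonempty (X × Bool) := nonempty_of_isProbabilityMeasure D
    exact this.map Prod.fst
  obtain ⟨H', hHH', hpH', hcard⟩ := exists_predictor_superset H (localPredictor f hf p)
  set k := distinguisherSize mUC ε δ γ H.card with hkdef
  have hε4 : ε / 4 ∈ Set.Ioo (0 : ℝ) 1 := ⟨by linarith [hε.1], by linarith [hε.2]⟩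
  have hδ4 : δ / 4 ∈ Set.Ioo (0 : ℝ) 1 := ⟨by linarith [hδ.1], by linarith [hδ.2]⟩
  have hDg : ∀ E : Measure (X × Bool), E.map Prod.fst = D.map Prod.fst →
      E.real (Prod.fst ⁻¹' g) = D.real (Prod.fst ⁻¹' g) := by
    intro E hE
    rw [measureReal_def, measureReal_def, ← Measure.map_apply measurable_fst hg, hE,
      Measure.map_apply measurable_fst hg]
  have hlog : 1 ≤ Real.log (4 / δ) := by
    rw [Real.le_log_iff_exp_le (by have := hδ.1; positivity), le_div_iff₀ hδ.1]
    have := Real.exp_one_lt_d9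
    nlinarith [hδ.1, hδ.2]
  have hk : 10 * (mUC (ε / 4) (δ / 4) H'.card : ℝ) ≤ k * D.real (Prod.fst ⁻¹' g) := by
    have h1 : 10 / γ * Real.log (4 / δ) * (mUC (ε / 4) (δ / 4) (H.card + 1) : ℝ) ≤ k :=
      Nat.le_ceil _
    rw [hcard]
    set m₀ : ℝ := (mUC (ε / 4) (δ / 4) (H.card + 1) : ℝ) with hm₀
    have hm₀0 : 0 ≤ m₀ := Nat.cast_nonneg _
    have hγ0 := hγ.1
    calc 10 * m₀ = 10 * 1 * m₀ := by ring
      _ ≤ 10 * Real.log (4 / δ) * m₀ := by gcongr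
      _ = 10 / γ * Real.log (4 / δ) * m₀ * γ := by field_simp
      _ ≤ k * D.real (Prod.fst ⁻¹' g) := by gcongr
  have hgpos : D (Prod.fst ⁻¹' g) ≠ 0 := by
    intro h0
    rw [measureReal_def, h0] at hgγ
    simp at hgγ
    linarith [hγ.1]
  have hDgp : IsProbabilityMeasure (restrictTo D g) :=
    ProbabilityTheory.cond_isProbabilityMeasure hgpos
  set D' := modeled D p with hD'
  have hk' : 10 * (mUC (ε / 4) (δ / 4) H'.card : ℝ) ≤ k * D'.real (Prod.fst ⁻¹' g) := by
    rw [hDg D' (modeled_map_fst D p)]; exact hk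
  have hu := iidLaw_group_deviation_le (k := k) hUC hε4 hδ4 H' D hg hk
  have hu' := iidLaw_group_deviation_le (k := k) hUC hε4 hδ4 H' D' hg hk'
  have hopt : L.risk (restrictTo D' g) (localPredictor f hf p) ≤ L.risk (restrictTo D' g) h := by
    rw [hD', restrictTo_modeled D p hg]
    exact hproper _ p (isCondMean_modeled _ p) h
  have hgap := hp (groupDistinguisher L f k (ε / 4) g h) ⟨g, hgG, h, hh, rfl⟩
  rw [acceptProb_groupDistinguisher L f hf, acceptProb_groupDistinguisher L f hf] at hgap
  set T := groupTest L f hf k (ε / 4) g h p with hT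
  have hTm : MeasurableSet T := by
    have h1 := measurableSet_groupTest (k := k) L f hf (ε / 4) hg h (Θ := PUnit) (p := fun _ => p)
      (p.2.comp measurable_snd)
    exact (measurable_prodMk_left (x := PUnit.unit)) h1
  have hlow : (iidLaw D k).real T ≤ 1 / 8 + δ / 4 := by
    refine (measureReal_mono ?_).trans hu
    rintro s hs ⟨hne, hdev⟩
    have e1 := abs_le.1 (hdev _ hpH')
    have e2 := abs_le.1 (hdev _ (hHH' hh))
    have e3 := hs hne
    linarith [hε.1]
  have hhigh : 1 - (iidLaw D' k).real T ≤ 1 / 8 + δ / 4 := by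
    rw [← probReal_compl_eq_one_sub hTm]
    refine (measureReal_mono ?_).trans hu'
    rintro s hs ⟨hne, hdev⟩
    apply hs
    intro _
    have e1 := abs_le.1 (hdev _ hpH')
    have e2 := abs_le.1 (hdev _ (hHH' hh))
    linarith [hε.1]
  have := (abs_le.1 hgap).1
  linarith [hδ.2]

end GroupTests

section PolynomialBounds

/-- Bounded by a polynomial in `1/ε`, `1/δ`, `1/γ`, `log a`, `log b`. -/
def PolyBounded (B : ℝ → ℝ → ℝ → ℕ → ℕ → ℝ) : Prop :=
  ∃ P : MvPolynomial (Fin 5) ℝ,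
    ∀ ε ∈ Set.Ioo (0 : ℝ) 1, ∀ δ ∈ Set.Ioo (0 : ℝ) 1, ∀ γ ∈ Set.Ioo (0 : ℝ) 1, ∀ a b : ℕ,
      |B ε δ γ a b| ≤ MvPolynomial.eval ![1 / ε, 1 / δ, 1 / γ, Real.log a, Real.log b] P

variable {B B' : ℝ → ℝ → ℝ → ℕ → ℕ → ℝ}

lemma PolyBounded.mono (h : PolyBounded B')
    (hle : ∀ ε ∈ Set.Ioo (0 : ℝ) 1, ∀ δ ∈ Set.Ioo (0 : ℝ) 1, ∀ γ ∈ Set.Ioo (0 : ℝ) 1, ∀ a b : ℕ,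
      |B ε δ γ a b| ≤ B' ε δ γ a b) : PolyBounded B := by
  obtain ⟨P, hP⟩ := h
  exact ⟨P, fun ε hε δ hδ γ hγ a b => (hle ε hε δ hδ γ hγ a b).trans
    ((le_abs_self _).trans (hP ε hε δ hδ γ hγ a b))⟩

lemma PolyBounded.const (c : ℝ) : PolyBounded (fun _ _ _ _ _ => c) :=
  ⟨MvPolynomial.C |c|, fun ε _ δ _ γ _ a b => by simp⟩

lemma PolyBounded.add (h : PolyBounded B) (h' : PolyBounded B') :
    PolyBounded (fun ε δ γ a b => B ε δ γ a b + B' ε δ γ a b) := by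
  obtain ⟨P, hP⟩ := h
  obtain ⟨Q, hQ⟩ := h'
  refine ⟨P + Q, fun ε hε δ hδ γ hγ a b => ?_⟩
  rw [map_add]
  exact (abs_add_le _ _).trans (add_le_add (hP ε hε δ hδ γ hγ a b) (hQ ε hε δ hδ γ hγ a b))

lemma PolyBounded.mul (h : PolyBounded B) (h' : PolyBounded B') :
    PolyBounded (fun ε δ γ a b => B ε δ γ a b * B' ε δ γ a b) := by
  obtain ⟨P, hP⟩ := h
  obtain ⟨Q, hQ⟩ := h'
  refine ⟨P * Q, fun ε hε δ hδ γ hγ a b => ?_⟩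
  rw [map_mul, abs_mul]
  exact mul_le_mul (hP ε hε δ hδ γ hγ a b) (hQ ε hε δ hδ γ hγ a b) (abs_nonneg _)
    ((abs_nonneg _).trans (hP ε hε δ hδ γ hγ a b))

lemma PolyBounded.inv_eps : PolyBounded (fun ε _ _ _ _ => 1 / ε) :=
  ⟨MvPolynomial.X 0, fun ε hε δ _ γ _ a b => by simp [abs_of_pos hε.1]⟩

lemma PolyBounded.inv_delta : PolyBounded (fun _ δ _ _ _ => 1 / δ) :=
  ⟨MvPolynomial.X 1, fun ε _ δ hδ γ _ a b => by simp [abs_of_pos hδ.1]⟩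

lemma PolyBounded.inv_gamma : PolyBounded (fun _ _ γ _ _ => 1 / γ) :=
  ⟨MvPolynomial.X 2, fun ε _ δ _ γ hγ a b => by simp [abs_of_pos hγ.1]⟩

lemma PolyBounded.log_left : PolyBounded (fun _ _ _ a _ => Real.log a) :=
  ⟨MvPolynomial.X 3, fun ε _ δ _ γ _ a b => by simp [abs_of_nonneg (Real.log_natCast_nonneg a)]⟩

lemma PolyBounded.log_right : PolyBounded (fun _ _ _ _ b => Real.log b) :=
  ⟨MvPolynomial.X 4, fun ε _ δ _ γ _ a b => by simp [abs_of_nonneg (Real.log_natCast_nonneg b)]⟩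

lemma PolyBounded.natCeil (h : PolyBounded B) :
    PolyBounded (fun ε δ γ a b => (⌈B ε δ γ a b⌉₊ : ℝ)) := by
  obtain ⟨P, hP⟩ := h
  refine ⟨P + MvPolynomial.C 1, fun ε hε δ hδ γ hγ a b => ?_⟩
  rw [map_add, MvPolynomial.eval_C, abs_of_nonneg (Nat.cast_nonneg _)]
  have h1 : (⌈B ε δ γ a b⌉₊ : ℝ) ≤ ⌈|B ε δ γ a b|⌉₊ := by
    exact_mod_cast Nat.ceil_mono (le_abs_self _)
  have h2 := (Nat.ceil_lt_add_one (abs_nonneg (B ε δ γ a b))).le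
  linarith [hP ε hε δ hδ γ hγ a b]

lemma PolyBounded.eval {σ : Type*} {V : σ → ℝ → ℝ → ℝ → ℕ → ℕ → ℝ} (hV : ∀ i, PolyBounded (V i))
    (P : MvPolynomial σ ℝ) :
    PolyBounded (fun ε δ γ a b => MvPolynomial.eval (fun i => V i ε δ γ a b) P) := by
  induction P using MvPolynomial.induction_on with
  | C c => simpa using PolyBounded.const c
  | add p q hp hq => simpa using hp.add hq
  | mul_X p i hp => simpa using hp.mul (hV i)

lemma PolyBounded.distinguisherSize {mUC : ℝ → ℝ → ℕ → ℕ}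
    (h : ∃ P : MvPolynomial (Fin 3) ℝ, ∀ ε ∈ Set.Ioo (0 : ℝ) 1, ∀ δ ∈ Set.Ioo (0 : ℝ) 1, ∀ k : ℕ,
      (mUC ε δ k : ℝ) ≤ MvPolynomial.eval ![1 / ε, 1 / δ, Real.log k] P) :
    PolyBounded (fun ε δ γ a _ => (distinguisherSize mUC ε δ γ a : ℝ)) := by
  obtain ⟨P, hP⟩ := h
  have h4 : PolyBounded (fun ε _ _ _ _ => 1 / (ε / 4)) :=
    ((PolyBounded.const 4).mul .inv_eps).mono fun ε hε δ hδ γ hγ a b => by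
      have := hε.1
      rw [abs_of_nonneg (by positivity)]
      exact le_of_eq (by field_simp)
  have h4' : PolyBounded (fun _ δ _ _ _ => 1 / (δ / 4)) :=
    ((PolyBounded.const 4).mul .inv_delta).mono fun ε hε δ hδ γ hγ a b => by
      have := hδ.1
      rw [abs_of_nonneg (by positivity)]
      exact le_of_eq (by field_simp)
  have hlog : PolyBounded (fun _ _ _ a _ => Real.log ((a + 1 : ℕ) : ℝ)) :=
    ((PolyBounded.const 1).add .log_left).mono fun ε hε δ hδ γ hγ a b => by
      rw [abs_of_nonneg (Real.log_natCast_nonneg _)]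
      rcases Nat.eq_zero_or_pos a with rfl | ha
      · simp
      · have ha' : (1 : ℝ) ≤ a := by exact_mod_cast ha
        calc Real.log ((a + 1 : ℕ) : ℝ) ≤ Real.log (2 * a) :=
              Real.log_le_log (by positivity) (by push_cast; linarith)
          _ = Real.log 2 + Real.log a := Real.log_mul (by norm_num) (by positivity)
          _ ≤ 1 + Real.log a := by linarith [Real.log_two_lt_d9]
  have hm : PolyBounded (fun ε δ _ a _ => (mUC (ε / 4) (δ / 4) (a + 1) : ℝ)) := by
    have := PolyBounded.eval (σ := Fin 3) (V := ![fun ε _ _ _ _ => 1 / (ε / 4),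
      fun _ δ _ _ _ => 1 / (δ / 4), fun _ _ _ a _ => Real.log ((a + 1 : ℕ) : ℝ)])
      (by intro i; fin_cases i <;> assumption) P
    refine this.mono fun ε hε δ hδ γ hγ a b => ?_
    rw [abs_of_nonneg (Nat.cast_nonneg _)]
    refine (hP (ε / 4) ⟨by linarith [hε.1], by linarith [hε.2]⟩ (δ / 4)
      ⟨by linarith [hδ.1], by linarith [hδ.2]⟩ (a + 1)).trans (le_of_eq ?_)
    congr 2
    ext i
    fin_cases i <;> rfl
  have hl : PolyBounded (fun _ δ _ _ _ => Real.log (4 / δ)) :=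
    ((PolyBounded.const 4).mul .inv_delta).mono fun ε hε δ hδ γ hγ a b => by
      have h0 := hδ.1
      have h1 : 1 ≤ 4 / δ := by rw [le_div_iff₀ h0]; linarith [hδ.2]
      rw [abs_of_nonneg (Real.log_nonneg h1)]
      have := Real.log_le_sub_one_of_pos (show 0 < 4 / δ by positivity)
      have e : 4 * (1 / δ) = 4 / δ := by ring
      linarith
  have hg : PolyBounded (fun _ _ γ _ _ => 10 / γ) :=
    ((PolyBounded.const 10).mul .inv_gamma).mono fun ε hε δ hδ γ hγ a b => by
      have := hγ.1
      rw [abs_of_nonneg (by positivity)]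
      exact le_of_eq (by field_simp)
  exact ((hg.mul hl).mul hm).natCeil

end PolynomialBounds

section Learner

/-- The number of rounds of boosting. -/
def roundCount (mUC : ℝ → ℝ → ℕ → ℕ) (ε δ γ : ℝ) (a : ℕ) : ℕ :=
  ⌈512 * (distinguisherSize mUC ε δ γ a : ℝ) ^ 2 / δ ^ 3⌉₊

/-- A bound for the logarithm of the number of updates. -/
def choiceExponent (mUC : ℝ → ℝ → ℕ → ℕ) (ε δ γ : ℝ) (a b : ℕ) : ℝ :=
  Real.log a + Real.log b + 3 * distinguisherSize mUC ε δ γ a + 3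

/-- The number of blocks on which the candidates are tested. -/
def testCount (mUC : ℝ → ℝ → ℕ → ℕ) (ε δ γ : ℝ) (a b : ℕ) : ℕ :=
  ⌈512 / δ ^ 2 * ((roundCount mUC ε δ γ a + 1) * choiceExponent mUC ε δ γ a b + 1 + 8 / δ)⌉₊

/-- The number of examples used by the learner. -/
def sampleCount (mUC : ℝ → ℝ → ℕ → ℕ) (ε δ γ : ℝ) (a b : ℕ) : ℕ :=
  (roundCount mUC ε δ γ a + testCount mUC ε δ γ a b) * distinguisherSize mUC ε δ γ a

lemma isPolySampleComplexity_sampleCount {mUC : ℝ → ℝ → ℕ → ℕ}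
    (h : ∃ P : MvPolynomial (Fin 3) ℝ, ∀ ε ∈ Set.Ioo (0 : ℝ) 1, ∀ δ ∈ Set.Ioo (0 : ℝ) 1, ∀ k : ℕ,
      (mUC ε δ k : ℝ) ≤ MvPolynomial.eval ![1 / ε, 1 / δ, Real.log k] P) :
    IsPolySampleComplexity (sampleCount mUC) := by
  have hk := PolyBounded.distinguisherSize h
  have hd := PolyBounded.inv_delta
  have hr : PolyBounded (fun ε δ γ a _ => (roundCount mUC ε δ γ a : ℝ)) := by
    refine PolyBounded.natCeil ?_
    have := ((PolyBounded.const 512).mul (hk.mul hk)).mul (hd.mul (hd.mul hd))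
    convert this using 6
    ring
  have hc : PolyBounded (fun ε δ γ a b => choiceExponent mUC ε δ γ a b) :=
    ((PolyBounded.log_left.add .log_right).add ((PolyBounded.const 3).mul hk)).add
      (PolyBounded.const 3)
  have hn : PolyBounded (fun ε δ γ a b => (testCount mUC ε δ γ a b : ℝ)) := by
    refine PolyBounded.natCeil ?_
    have := ((PolyBounded.const 512).mul (hd.mul hd)).mul
      ((((hr.add (PolyBounded.const 1)).mul hc).add (PolyBounded.const 1)).add
        ((PolyBounded.const 8).mul hd))
    convert this using 6
    ring
  obtain ⟨P, hP⟩ := (hr.add hn).mul hk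
  refine ⟨P, fun ε hε δ hδ γ hγ a b => le_trans (le_of_eq ?_)
    ((le_abs_self _).trans (hP ε hε δ hδ γ hγ a b))⟩
  simp [sampleCount]

lemma natCast_mul_le_exp (a b : ℕ) : (a * b : ℝ) ≤ Real.exp (Real.log a + Real.log b) := by
  rcases Nat.eq_zero_or_pos a with rfl | ha
  · simpa using (Real.exp_pos _).le
  rcases Nat.eq_zero_or_pos b with rfl | hb
  · simpa using (Real.exp_pos _).le
  rw [Real.exp_add, Real.exp_log (by exact_mod_cast ha), Real.exp_log (by exact_mod_cast hb)]

lemma card_choice_le_exp {ι : Type*} [Fintype ι] {a b k : ℕ} (hι : Fintype.card ι = a * b) :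
    (Fintype.card (Choice ι k) : ℝ) ≤ Real.exp (Real.log a + Real.log b + 3 * k + 3) := by
  have hc : Fintype.card (Choice ι k) = a * b * (k * (2 ^ k * 2)) + 1 := by
    simp [Choice, Fintype.card_option, Fintype.card_prod, hι]
  rw [hc]
  push_cast
  have h0 : (0 : ℝ) ≤ Real.log a + Real.log b :=
    add_nonneg (Real.log_natCast_nonneg a) (Real.log_natCast_nonneg b)
  have h1 := natCast_mul_le_exp a b
  have hk : (k : ℝ) ≤ Real.exp k := by linarith [Real.add_one_le_exp (k : ℝ)]
  have h2 : (2 : ℝ) ≤ Real.exp 1 := by linarith [Real.add_one_le_exp (1 : ℝ)]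
  have h2k : (2 : ℝ) ^ k ≤ Real.exp k := by
    calc (2 : ℝ) ^ k ≤ (Real.exp 1) ^ k := pow_le_pow_left₀ (by norm_num) h2 k
      _ = Real.exp k := by rw [← Real.exp_nat_mul, mul_one]
  have h3 : (a * b : ℝ) * (k * (2 ^ k * 2)) ≤
      Real.exp (Real.log a + Real.log b + 2 * k + 1) := by
    calc (a * b : ℝ) * (k * (2 ^ k * 2)) ≤
        Real.exp (Real.log a + Real.log b) * (Real.exp k * (Real.exp k * Real.exp 1)) := by gcongr
      _ = _ := by rw [← Real.exp_add, ← Real.exp_add, ← Real.exp_add]; congr 1; ring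
  have h4 : Real.exp (Real.log a + Real.log b + 2 * k + 1) + 1 ≤
      2 * Real.exp (Real.log a + Real.log b + 2 * k + 1) := by
    have : (1 : ℝ) ≤ Real.exp (Real.log a + Real.log b + 2 * k + 1) :=
      Real.one_le_exp (by positivity)
    linarith
  calc _ ≤ 2 * Real.exp (Real.log a + Real.log b + 2 * k + 1) := by linarith
    _ ≤ Real.exp 1 * Real.exp (Real.log a + Real.log b + 2 * k + 1) := by gcongr
    _ = Real.exp (Real.log a + Real.log b + 2 * k + 2) := by rw [← Real.exp_add]; congr 1; ring
    _ ≤ _ := Real.exp_le_exp.2 (by linarith [(Nat.cast_nonneg k : (0 : ℝ) ≤ k)])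

lemma testCount_bound (mUC : ℝ → ℝ → ℕ → ℕ) (ε γ : ℝ) {δ : ℝ} (hδ : 0 < δ) {a b : ℕ}
    {ι : Type*} [Fintype ι] (hι : Fintype.card ι = a * b) :
    (Fintype.card (Choice ι (distinguisherSize mUC ε δ γ a)) : ℝ) ^ (roundCount mUC ε δ γ a) *
      Fintype.card ι * (2 * Real.exp (-(testCount mUC ε δ γ a b * (δ / 4 / 4) ^ 2 / 2))) ≤
      δ / 8 := by
  set k := distinguisherSize mUC ε δ γ a
  set r := roundCount mUC ε δ γ a
  set Λ := choiceExponent mUC ε δ γ a b with hΛ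
  have h1 : (Fintype.card (Choice ι k) : ℝ) ≤ Real.exp Λ := card_choice_le_exp hι
  have h2 : (Fintype.card ι : ℝ) ≤ Real.exp Λ := by
    rw [hι]
    push_cast
    refine (natCast_mul_le_exp a b).trans (Real.exp_le_exp.2 ?_)
    rw [hΛ, choiceExponent]
    linarith [(Nat.cast_nonneg k : (0 : ℝ) ≤ k)]
  have h3 : (2 : ℝ) ≤ Real.exp 1 := by linarith [Real.add_one_le_exp (1 : ℝ)]
  have hn : 512 / δ ^ 2 * ((r + 1) * Λ + 1 + 8 / δ) ≤ testCount mUC ε δ γ a b := Nat.le_ceil _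
  set n : ℝ := (testCount mUC ε δ γ a b : ℝ)
  have hn' : (r + 1) * Λ + 1 + 8 / δ ≤ n * (δ / 4 / 4) ^ 2 / 2 := by
    calc (r + 1) * Λ + 1 + 8 / δ = (512 / δ ^ 2 * ((r + 1) * Λ + 1 + 8 / δ)) * (δ ^ 2 / 512) := by
          field_simp
      _ ≤ n * (δ ^ 2 / 512) := by gcongr
      _ = _ := by ring
  have hexp : Real.exp (-(8 / δ)) ≤ δ / 8 := by
    have h8 : 8 / δ ≤ Real.exp (8 / δ) := by linarith [Real.add_one_le_exp (8 / δ)]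
    rw [Real.exp_neg, inv_le_comm₀ (Real.exp_pos _) (by positivity), inv_div]
    exact h8
  calc _ ≤ Real.exp Λ ^ r * Real.exp Λ *
        (Real.exp 1 * Real.exp (-((r + 1) * Λ + 1 + 8 / δ))) := by gcongr
    _ = Real.exp (-(8 / δ)) := by
        rw [← Real.exp_nat_mul, ← Real.exp_add, ← Real.exp_add, ← Real.exp_add]
        congr 1; ring
    _ ≤ δ / 8 := hexp

variable {X : Type u} [MeasurableSpace X]

/-- The tests `A_{g,h}` as a family indexed by the pairs `(g, h)`. -/
def groupTests (L : Loss X) (f : X × unitInterval → unitInterval) (hf : Measurable f) (k : ℕ)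
    (α : ℝ) (H : Finset (Predictor X)) (G : Finset (Set X)) :
    (G × H) → Predictor X → Set (Fin k → X × Bool) :=
  fun gh p => groupTest L f hf k α gh.1 gh.2 p

lemma measurableTests_groupTests (L : Loss X) (f : X × unitInterval → unitInterval)
    (hf : Measurable f) (k : ℕ) (α : ℝ) (H : Finset (Predictor X)) {G : Finset (Set X)}
    (hG : ∀ g ∈ G, MeasurableSet g) : MeasurableTests (groupTests L f hf k α H G) :=
  fun gh _ _ _ hp => measurableSet_groupTest L f hf α (hG gh.1 gh.1.2) gh.2 hp

/-- The positions in a sample of size `m` of the blocks used for boosting and for testing. -/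
def blockIndex {m r n k : ℕ} (h : (r + n) * k ≤ m) (x : (Fin r ⊕ Fin n) × Fin k) : Fin m :=
  Fin.castLE h (finProdFinEquiv (finSumFinEquiv x.1, x.2))

lemma blockIndex_injective {m r n k : ℕ} (h : (r + n) * k ≤ m) :
    Function.Injective (blockIndex h : (Fin r ⊕ Fin n) × Fin k → Fin m) := by
  intro x y hxy
  have h1 := finProdFinEquiv.injective (Fin.castLE_injective h hxy)
  rw [Prod.mk.injEq] at h1
  exact Prod.ext (finSumFinEquiv.injective h1.1) h1.2

/-- The predictor that always outputs `0`. -/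
def zeroPredictor (X : Type u) [MeasurableSpace X] : Predictor X := ⟨fun _ => 0, measurable_const⟩

open Classical in
/-- The learner that boosts on the first blocks of the sample and selects the output by testing
on the remaining ones. -/
def indistLearner (L : Loss X) (f : X × unitInterval → unitInterval) (hf : Measurable f)
    (mUC : ℝ → ℝ → ℕ → ℕ) : Learner X Unit :=
  fun ε δ γ H G m S _ =>
    if h : (∀ g ∈ G, MeasurableSet g) ∧ sampleCount mUC ε δ γ H.card G.card ≤ m then
      boostLearner (measurableTests_groupTests L f hf (distinguisherSize mUC ε δ γ H.card)
          (ε / 4) H h.1) (δ / 4 / 2 / distinguisherSize mUC ε δ γ H.card) (δ / 4)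
        (roundCount mUC ε δ γ H.card) (testCount mUC ε δ γ H.card G.card)
        (zeroPredictor X)
        ((fun i l => S (blockIndex h.2 (Sum.inl i, l))),
          (fun j l => S (blockIndex h.2 (Sum.inr j, l))))
    else zeroPredictor X

theorem isOutcomeIndistLearner_indistLearner [MeasurableSingletonClass X] (L : Loss X)
    (f : X × unitInterval → unitInterval) (hf : Measurable f) {mUC : ℝ → ℝ → ℕ → ℕ}
    (hUC : HasUniformConvergence L mUC) :
    IsOutcomeIndistLearner L f mUC (sampleCount mUC) (Measure.dirac ())
      (indistLearner L f hf mUC) := by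
  intro ε hε δ hδ γ hγ H G hG D _ m hm
  have hδ0 := hδ.1
  set k := distinguisherSize mUC ε δ γ H.card with hk
  set r := roundCount mUC ε δ γ H.card with hr
  set n := testCount mUC ε δ γ H.card G.card with hn
  have hAcc := measurableTests_groupTests L f hf k (ε / 4) H hG
  have hkpos : 0 < k := by
    refine Nat.ceil_pos.2 ?_
    have h1 : 1 ≤ mUC (ε / 4) (δ / 4) (H.card + 1) :=
      hUC.1 _ ⟨by linarith [hε.1], by linarith [hε.2]⟩ _ ⟨by linarith, by linarith [hδ.2]⟩ _
    have h2 : (0 : ℝ) < mUC (ε / 4) (δ / 4) (H.card + 1) := by exact_mod_cast h1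
    have h3 : 0 < Real.log (4 / δ) := Real.log_pos (by rw [lt_div_iff₀ hδ0]; linarith [hδ.2])
    have := hγ.1
    positivity
  have hk0 : (0 : ℝ) < k := by exact_mod_cast hkpos
  have hnpos : 0 < n := by
    refine Nat.ceil_pos.2 ?_
    have h1 : 0 ≤ choiceExponent mUC ε δ γ H.card G.card := by
      have := Real.log_natCast_nonneg H.card
      have := Real.log_natCast_nonneg G.card
      unfold choiceExponent
      positivity
    positivity
  have hcard : Fintype.card (G × H) = H.card * G.card := by
    rw [Fintype.card_prod, Fintype.card_coe, Fintype.card_coe, mul_comm]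
  have hround : 1 ≤ δ / 8 * (r * (δ / 4 / 2 / k) ^ 2) := by
    have h1 : 512 * (k : ℝ) ^ 2 / δ ^ 3 ≤ r := Nat.le_ceil _
    calc (1 : ℝ) = δ / 8 * (512 * (k : ℝ) ^ 2 / δ ^ 3 * (δ / 4 / 2 / k) ^ 2) := by
          field_simp; norm_num
      _ ≤ _ := by gcongr
  have hmain := boostLearner_fail_measure_le hAcc D (τ := δ / 4) (δ₁ := δ / 8) (δ₂ := δ / 8)
    (by positivity) hkpos (r := r) (n := n) hnpos (zeroPredictor X) hround
    (testCount_bound mUC ε γ hδ0 hcard)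
  set W := {z | ¬ ∀ a, |gap D (boostLearner hAcc (δ / 4 / 2 / k) (δ / 4) r n
    (zeroPredictor X) z) (groupTests L f hf k (ε / 4) H G a (boostLearner hAcc
      (δ / 4 / 2 / k) (δ / 4) r n (zeroPredictor X) z))| ≤ δ / 4} with hW
  set T : (Fin m → X × Bool) → (Fin r → Fin k → X × Bool) × (Fin n → Fin k → X × Bool) :=
    fun S => ((fun i l => S (blockIndex hm (Sum.inl i, l))),
      (fun j l => S (blockIndex hm (Sum.inr j, l)))) with hT
  have hTm : Measurable T := by fun_prop
  have hsub : {s : (Fin m → X × Bool) × Unit | ¬ IsOutcomeIndist D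
      (groupDistinguishers L f k (ε / 4) H G) (δ / 4)
      (indistLearner L f hf mUC ε δ γ H G m s.1 s.2)} ⊆ Prod.fst ⁻¹' (T ⁻¹' W) := by
    intro s hs
    by_contra hcon
    refine hs ?_
    rintro A ⟨g, hg, h, hh, rfl⟩
    have hcon' := not_not.1 hcon (⟨g, hg⟩, ⟨h, hh⟩)
    rw [acceptProb_groupDistinguisher L f hf, acceptProb_groupDistinguisher L f hf]
    have hO : indistLearner L f hf mUC ε δ γ H G m s.1 s.2 = boostLearner hAcc (δ / 4 / 2 / k)
        (δ / 4) r n (zeroPredictor X) (T s.1) := dif_pos ⟨hG, hm⟩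
    rw [hO]
    exact hcon'
  have hfst : ((iidLaw D m).prod (Measure.dirac ())).map Prod.fst = iidLaw D m :=
    (measurePreserving_fst (μ := iidLaw D m) (ν := Measure.dirac ())).map_eq
  calc _ ≤ ((iidLaw D m).prod (Measure.dirac ())) (Prod.fst ⁻¹' (T ⁻¹' W)) := measure_mono hsub
    _ ≤ ((iidLaw D m).prod (Measure.dirac ())).map Prod.fst (T ⁻¹' W) :=
        Measure.le_map_apply measurable_fst.aemeasurable _
    _ = iidLaw D m (T ⁻¹' W) := by rw [hfst]
    _ ≤ (iidLaw D m).map T W := Measure.le_map_apply hTm.aemeasurable _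
    _ ≤ ENNReal.ofReal (δ / 8 + δ / 8) := by
        rw [hT, iidLaw_map_blocks D (blockIndex hm) (blockIndex_injective hm)]
        exact hmain
    _ = ENNReal.ofReal (δ / 4) := by congr 1; ring

end Learner

end MultiGroup

end

theorem lemma4p4 {X : Type u} [MeasurableSpace X] [MeasurableSingletonClass X]
    (L : MultiGroup.Loss X) (f : X × unitInterval → unitInterval) (hf : Measurable f)
    (hproper : MultiGroup.IsProper L f hf)
    (mUC : ℝ → ℝ → ℕ → ℕ) (hUC : MultiGroup.HasUniformConvergence L mUC) :
    MultiGroup.MultiGroupLearnable L ∧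
    ∃ mL : ℝ → ℝ → ℝ → ℕ → ℕ → ℕ, MultiGroup.IsPolySampleComplexity mL ∧
      ∃ (Ω : Type) (_ : MeasurableSpace Ω) (ν : MeasureTheory.Measure Ω)
        (_ : MeasureTheory.IsProbabilityMeasure ν) (O : MultiGroup.Learner X Ω),
        MultiGroup.IsOutcomeIndistLearner L f mUC mL ν O ∧
        MultiGroup.IsMultiGroupLearner L mL ν
          (fun ε δ γ H G m S ω => MultiGroup.localPredictor f hf (O ε δ γ H G m S ω)) := by
  have hpoly := MultiGroup.isPolySampleComplexity_sampleCount hUC.2.2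
  have hO := MultiGroup.isOutcomeIndistLearner_indistLearner L f hf hUC
  have hM : MultiGroup.IsMultiGroupLearner L (MultiGroup.sampleCount mUC)
      (MeasureTheory.Measure.dirac ()) (fun ε δ γ H G m S ω =>
        MultiGroup.localPredictor f hf (MultiGroup.indistLearner L f hf mUC ε δ γ H G m S ω)) := by
    intro ε hε δ hδ γ hγ H G hG D _ m hm
    refine (MeasureTheory.measure_mono ?_).trans ((hO ε hε δ hδ γ hγ H G hG D m hm).trans
      (ENNReal.ofReal_le_ofReal (by linarith [hδ.1])))
    intro s hs hind
    exact hs (MultiGroup.isMultiGroupCompetitive_of_isOutcomeIndist hproper hUC hε hδ hγ H G hG D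
      _ hind)
  exact ⟨⟨_, hpoly, Unit, inferInstance, _, inferInstance, _, hM⟩,
    _, hpoly, Unit, inferInstance, _, inferInstance, _, hO, hM⟩
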